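/- Let $d\ge 1$. For a finite signed measure $\mu$ on $\mathbb{R}^d$ put $F_\mu(r,y)=\mu(\{x:|x-y|\le r\})$ for $r>0$, $y\in\mathbb{R}^d$. For $F:\mathbb{R}\to\mathbb{R}$ define $\Delta_0F(r)=F(r)-F(r/2)$ and $\Delta_{k+1}F(r)=\Delta_kF(r)-2^{k+1}\Delta_kF(r/2)$. For $\alpha>0$ and $1\le p,q\le\infty$ let $k=\lceil\alpha+d-1\rceil$ and $$\|\mu\|_{\mathrm{SBE}^{\alpha,p}_q}=\Big\|\,y\mapsto\big\|\,r^{-\alpha-d}\,(\Delta_k)_rF_\mu(r,y)\big\|_{L^p((0,\infty),dr/r)}\Big\|_{L^q(\mathbb{R}^d,dy)}\in[0,\infty].$$ Let $\chi\in C^\infty(\mathbb{R}^d;\mathbb{R})$ satisfy $\chi(\xi)=1$ for $|\xi|\le1$ and $\chi(\xi)=0$ for $|\xi|\ge2$; put $\chi_0=\chi$ and $\chi_j(\xi)=\chi(2^{-j}\xi)-\chi(2^{-(j-1)}\xi)$ for $j\ge1$. For $f\in L^1(\mathbb{R}^d)$ let $P_jf=\mathcal{F}^{-1}(\chi_j)\star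 f$, and let $$\|f\|_{B^\alpha_{q,1}}=\sum_{j\ge0}2^{j\alpha}\|P_jf\|_{L^q(\mathbb{R}^d)}$$ be the corresponding Besov norm. **Proposition.** Let $\alpha>0$ with $\alpha\notin\mathbb{N}$, and let $1\le q\le\infty$. Then for every $1\le p\le\infty$ there is a constant $C$, depending only on $d,\alpha,p,q$ and $\chi$, such that for every compactly supported finite signed measure $\mu=f\,dx$ on $\mathbb{R}^d$ whose density $f\in L^1(\mathbb{R}^d)$ belongs to $B^\alpha_{q,1}$, that is, $\|f\|_{B^\alpha_{q,1}}<\infty$, $$\|\mu\|_{\mathrm{SBE}^{\alpha,p}_q}\le C\,\|f\|_{B^\alpha_{q,1}}.$$ -/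

import Mathlib

open MeasureTheory Set FourierTransform
open scoped ENNReal NNReal ContDiff

noncomputable section

/-- `F_μ(r, y) = μ({x : |x - y| ≤ r})`, the mass of the closed ball of radius `r` and centre `y`,
for a finite (signed) measure `μ` on `ℝ^d`. -/
def ballMass {d : ℕ} (μ : SignedMeasure (EuclideanSpace ℝ (Fin d))) (r : ℝ)
    (y : EuclideanSpace ℝ (Fin d)) : ℝ :=
  μ (Metric.closedBall y r)

/-- The dyadic difference operators `Δ_k`. -/
def dyadicDiff : ℕ → (ℝ → ℝ) → ℝ → ℝ
  | 0, F, r => F r - F (r / 2)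
  | k + 1, F, r => dyadicDiff k F r - 2 ^ (k + 1) * dyadicDiff k F (r / 2)

/-- The measure `dr / r` on `(0, ∞)`. -/
def haarPos : Measure ℝ :=
  (volume.restrict (Ioi (0 : ℝ))).withDensity fun r => ENNReal.ofReal r⁻¹

/-- The order `k = ⌈α + d - 1⌉` of the difference operator used in the small ball estimate. -/
def sbeOrder (d : ℕ) (α : ℝ) : ℕ := ⌈α + d - 1⌉₊

/-- The `SBE^{α,p}_q` norm, with values in `[0, ∞]`: the `L^q(dy)` norm of the `L^p(dr/r)` norm
of `r^{-α-d} (Δ_k)_r F_μ(r, y)`. -/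
def sbeNorm {d : ℕ} (α : ℝ) (p q : ℝ≥0∞) (μ : SignedMeasure (EuclideanSpace ℝ (Fin d))) : ℝ≥0∞ :=
  eLpNorm
    (fun y : EuclideanSpace ℝ (Fin d) =>
      eLpNorm
        (fun r : ℝ => r ^ (-α - (d : ℝ)) * dyadicDiff (sbeOrder d α) (fun s => ballMass μ s y) r)
        p haarPos)
    q volume

/-- `μ` vanishes on the measurable subsets of the complement of some compact set. -/
def CompactlySupported {d : ℕ} (μ : SignedMeasure (EuclideanSpace ℝ (Fin d))) : Prop :=
  ∃ K : Set (EuclideanSpace ℝ (Fin d)), IsCompact K ∧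
    ∀ A : Set (EuclideanSpace ℝ (Fin d)), MeasurableSet A → Disjoint A K → μ A = 0

/-- A smooth cutoff on the frequency side, equal to `1` for `|ξ| ≤ 1` and to `0` for `|ξ| ≥ 2`;
it generates a Littlewood–Paley decomposition. -/
structure FrequencyCutoff (d : ℕ) where
  toFun : EuclideanSpace ℝ (Fin d) → ℝ
  smooth : ContDiff ℝ ∞ toFun
  eq_one : ∀ ξ, ‖ξ‖ ≤ 1 → toFun ξ = 1
  eq_zero : ∀ ξ, 2 ≤ ‖ξ‖ → toFun ξ = 0

namespace FrequencyCutoff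

variable {d : ℕ}

/-- The dyadic partition of unity: `χ(ξ)` for `j = 0` and `χ(2^{-j} ξ) - χ(2^{-(j-1)} ξ)` for
`j ≥ 1`. -/
def symbol (χ : FrequencyCutoff d) : ℕ → EuclideanSpace ℝ (Fin d) → ℝ
  | 0, ξ => χ.toFun ξ
  | j + 1, ξ => χ.toFun (((2 : ℝ) ^ (j + 1))⁻¹ • ξ) - χ.toFun (((2 : ℝ) ^ j)⁻¹ • ξ)

/-- The inverse Fourier transform of the `j`-th symbol. -/
def kernel (χ : FrequencyCutoff d) (j : ℕ) : EuclideanSpace ℝ (Fin d) → ℂ :=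
  𝓕⁻ fun ξ : EuclideanSpace ℝ (Fin d) => (χ.symbol j ξ : ℂ)

/-- The `j`-th Littlewood–Paley block of an integrable function `f`: the convolution of `f` with
the `j`-th kernel, that is, the Fourier multiplier with the `j`-th symbol applied to `f`. -/
def block (χ : FrequencyCutoff d) (j : ℕ) (f : EuclideanSpace ℝ (Fin d) → ℝ) :
    EuclideanSpace ℝ (Fin d) → ℂ :=
  fun x => ∫ y, χ.kernel j (x - y) * (f y : ℂ)

/-- The Besov norm of `B^s_{q,m}(ℝ^d)`, with values in `[0, ∞]`, of an integrable function: the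
`ℓ^m` norm over `j ≥ 0` of `2^{js}` times the `L^q` norm of the `j`-th block. -/
def besovNorm (χ : FrequencyCutoff d) (s : ℝ) (q m : ℝ≥0∞)
    (f : EuclideanSpace ℝ (Fin d) → ℝ) : ℝ≥0∞ :=
  eLpNorm (fun j : ℕ => ENNReal.ofReal ((2 : ℝ) ^ ((j : ℝ) * s)) * eLpNorm (χ.block j f) q volume)
    m Measure.count

/-- Membership of an integrable function in the Besov space `B^s_{q,m}(ℝ^d)`. -/
def MemBesov (χ : FrequencyCutoff d) (s : ℝ) (q m : ℝ≥0∞)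
    (f : EuclideanSpace ℝ (Fin d) → ℝ) : Prop :=
  χ.besovNorm s q m f < ⊤

end FrequencyCutoff

end

/-! ### Minkowski and Young inequalities for `[0, ∞]`-valued functions -/

noncomputable section

/-! In `y`, `Δ_k F_μ(r, ·)` is the convolution of `f` with a radial step function `S_r = ∑ c_i
1_{B(0, r/2^i)}`. Since `Δ_k` kills `r^l` for `l ≤ k`, and `k = d + ⌊α⌋` for non-integer `α`, `S_r`
acts on smooth functions as a high-order difference: for Schwartz `ψ`, `S_r * ψ` is `O(r^{d+⌊α⌋+1})`
as `r → 0` (Taylor), and with weight `(1+|x|)^{-γ}` it is `O(r^γ)` as `r → ∞`. With `γ = d + α/2`,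
both bounds are `r^{α+d} min(r^ε, r^{-ε})` or better for some `ε > 0` (`exists_norm_shellConv_le`).

Write `f = ∑ P_j f`. The low-pass kernel `φ_{j+1}` reproduces `P_j f`, so `S_r * P_j f = (S_r *
φ_{j+1}) * P_j f`, and dilation reduces `S_r * φ_{j+1}` to `φ_0` at radius `2^{j+1} r`. Hence
`r^{-α-d} |S_r * P_j f|` is at most a bump in `2^{j+1} r`, whose `L^p(dr/r)` norm is bounded
uniformly in `j`, times a convolution of `|P_j f|` with a weight. Young's inequality in `y` costs
`2^{-(j+1)d}`, leaving `2^{jα} ‖P_j f‖_q`, and the triangle inequality sums over `j`. -/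

theorem ENNReal.eLpNorm_eq_lintegral_rpow {X : Type*} [MeasurableSpace X] {μ : Measure X}
    {p : ℝ≥0∞} (hp : 1 ≤ p) (hpt : p ≠ ⊤) (f : X → ℝ≥0∞) :
    eLpNorm f p μ = (∫⁻ x, f x ^ p.toReal ∂μ) ^ (1 / p.toReal) := by
  rw [eLpNorm_eq_lintegral_rpow_enorm_toReal (by positivity) hpt]
  simp

/-- The countable triangle inequality for `eLpNorm`. -/
theorem ENNReal.eLpNorm_tsum_le {X : Type*} [MeasurableSpace X] {μ : Measure X}
    {p : ℝ≥0∞} (hp : 1 ≤ p) (f : ℕ → X → ℝ≥0∞) (hf : ∀ j, Measurable (f j)) :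
    eLpNorm (fun x => ∑' j, f j x) p μ ≤ ∑' j, eLpNorm (f j) p μ := by
  have hfin : ∀ n, eLpNorm (fun x => ∑ j ∈ Finset.range n, f j x) p μ ≤ ∑' j, eLpNorm (f j) p μ := by
    intro n
    have h := eLpNorm_sum_le (s := Finset.range n) (f := f) (p := p) (μ := μ)
      (fun i _ => (hf i).aestronglyMeasurable) hp
    have e : (fun x => ∑ j ∈ Finset.range n, f j x) = ∑ j ∈ Finset.range n, f j := by
      ext x; simp
    rw [e]
    exact h.trans (ENNReal.sum_le_tsum _)
  by_cases hpt : p = ⊤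
  · subst hpt
    simp only [eLpNorm_exponent_top, eLpNormEssSup] at hfin ⊢
    refine essSup_le_of_ae_le _ ?_
    have : ∀ᵐ x ∂μ, ∀ j, ‖f j x‖ₑ ≤ essSup (fun x => ‖f j x‖ₑ) μ :=
      ae_all_iff.2 fun j => ENNReal.ae_le_essSup _
    filter_upwards [this] with x hx
    exact ENNReal.tsum_le_tsum hx
  · have hp0 : 0 < p.toReal := ENNReal.toReal_pos (by positivity) hpt
    simp only [ENNReal.eLpNorm_eq_lintegral_rpow hp hpt] at hfin ⊢
    set S := ∑' j, (∫⁻ x, f j x ^ p.toReal ∂μ) ^ (1 / p.toReal)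
    rw [one_div, ENNReal.rpow_inv_le_iff hp0]
    -- Monotone convergence carries the bound on partial sums over to the series.
    have e : ∀ x, (∑' j, f j x) ^ p.toReal
        = ⨆ n, (∑ j ∈ Finset.range n, f j x) ^ p.toReal := by
      intro x
      rw [ENNReal.tsum_eq_iSup_nat]
      exact (ENNReal.orderIsoRpow p.toReal hp0).map_iSup _
    simp_rw [e]
    rw [lintegral_iSup]
    · refine iSup_le fun n => ?_
      have := hfin n
      rwa [one_div, ENNReal.rpow_inv_le_iff hp0] at this
    · intro n
      exact (Finset.measurable_sum _ fun i _ => hf i).pow_const _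
    · intro a b hab x
      exact ENNReal.rpow_le_rpow
        (Finset.sum_le_sum_of_subset (Finset.range_mono hab)) hp0.le

/-- Young's convolution inequality `L¹ * L^q ⊆ L^q`. -/
theorem ENNReal.eLpNorm_lconvolution_le {G : Type*} [AddCommGroup G] [MeasurableSpace G]
    [MeasurableAdd₂ G] [MeasurableNeg G] (μ : Measure G) [SFinite μ] [μ.IsAddLeftInvariant]
    [μ.IsNegInvariant]
    {q : ℝ≥0∞} (hq : 1 ≤ q) (φ g : G → ℝ≥0∞) (hφ : Measurable φ) (hg : Measurable g) :
    eLpNorm (fun y => ∫⁻ t, φ (y - t) * g t ∂μ) q μ ≤ (∫⁻ t, φ t ∂μ) * eLpNorm g q μ := by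
  have hφ' : ∀ y, ∫⁻ t, φ (y - t) ∂μ = ∫⁻ t, φ t ∂μ := fun y => lintegral_sub_left_eq_self φ y
  have key : ∀ u : G → ℝ≥0∞, Measurable u →
      ∫⁻ y, ∫⁻ t, φ (y - t) * u t ∂μ ∂μ = (∫⁻ t, φ t ∂μ) * ∫⁻ t, u t ∂μ := by
    intro u hu
    rw [lintegral_lintegral_swap]
    · have : ∀ t, ∫⁻ y, φ (y - t) * u t ∂μ = (∫⁻ y, φ y ∂μ) * u t := by
        intro t
        rw [lintegral_mul_const _ (by fun_prop), lintegral_sub_right_eq_self φ t]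
      simp_rw [this]
      rw [lintegral_const_mul _ hu]
    · exact (by fun_prop : Measurable _).aemeasurable
  by_cases hqt : q = ⊤
  · subst hqt
    simp only [eLpNorm_exponent_top, eLpNormEssSup]
    refine essSup_le_of_ae_le _ (Filter.Eventually.of_forall fun y => ?_)
    calc ∫⁻ t, φ (y - t) * g t ∂μ
        ≤ ∫⁻ t, φ (y - t) * essSup (fun x => ‖g x‖ₑ) μ ∂μ := by
          refine lintegral_mono_ae ?_
          filter_upwards [ENNReal.ae_le_essSup (μ := μ) (fun x => ‖g x‖ₑ)] with t ht
          exact mul_le_mul_right ht _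
      _ = _ := by rw [lintegral_mul_const _ (by fun_prop), hφ' y]
  have hp0 : 0 < q.toReal := ENNReal.toReal_pos (by positivity) hqt
  have hp1 : 1 ≤ q.toReal := by
    rw [← ENNReal.toReal_one]; exact ENNReal.toReal_mono hqt hq
  simp only [ENNReal.eLpNorm_eq_lintegral_rpow hq hqt]
  set s := q.toReal
  set A := ∫⁻ t, φ t ∂μ
  rcases hp1.eq_or_lt with hs | hs
  · rw [← hs]
    simp only [ENNReal.rpow_one, one_div, inv_one]
    exact (key g hg).le
  have hpq : s.HolderConjugate (s / (s - 1)) := Real.HolderConjugate.conjExponent hs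
  have hs1 : 0 < s - 1 := by linarith
  -- Hölder for the splitting `φ = φ^{1/s} φ^{(s-1)/s}`, with `g` attached to the first factor;
  -- `key` (Tonelli) then integrates in `y`.
  have holder : ∀ y, (∫⁻ t, φ (y - t) * g t ∂μ) ^ s ≤
      A ^ (s - 1) * ∫⁻ t, φ (y - t) * g t ^ s ∂μ := by
    intro y
    have h := ENNReal.lintegral_mul_le_Lp_mul_Lq μ hpq
      (f := fun t => φ (y - t) ^ (1 / s) * g t) (g := fun t => φ (y - t) ^ ((s - 1) / s))
      (by fun_prop) (by fun_prop)
    have e1 : ∀ t, ((fun t => φ (y - t) ^ (1 / s) * g t) * fun t => φ (y - t) ^ ((s - 1) / s)) t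
        = φ (y - t) * g t := by
      intro t
      simp only [Pi.mul_apply]
      rw [mul_right_comm, ← ENNReal.rpow_add_of_nonneg _ _ (by positivity) (by positivity)]
      rw [show 1 / s + (s - 1) / s = 1 by field_simp; ring, ENNReal.rpow_one]
    have e2 : ∀ t, (φ (y - t) ^ (1 / s) * g t) ^ s = φ (y - t) * g t ^ s := by
      intro t
      rw [ENNReal.mul_rpow_of_nonneg _ _ hp0.le, ← ENNReal.rpow_mul,
        one_div_mul_cancel hp0.ne', ENNReal.rpow_one]
    have e3 : ∀ t, (φ (y - t) ^ ((s - 1) / s)) ^ (s / (s - 1)) = φ (y - t) := by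
      intro t
      rw [← ENNReal.rpow_mul, show (s - 1) / s * (s / (s - 1)) = 1 by field_simp, ENNReal.rpow_one]
    simp_rw [e1, e2, e3, hφ' y] at h
    calc _ ≤ ((∫⁻ t, φ (y - t) * g t ^ s ∂μ) ^ (1 / s) * A ^ (1 / (s / (s - 1)))) ^ s :=
          ENNReal.rpow_le_rpow h hp0.le
      _ = _ := by
        rw [ENNReal.mul_rpow_of_nonneg _ _ hp0.le, ← ENNReal.rpow_mul, ← ENNReal.rpow_mul,
          one_div_mul_cancel hp0.ne', ENNReal.rpow_one,
          show 1 / (s / (s - 1)) * s = s - 1 by field_simp, mul_comm]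
  calc (∫⁻ y, (∫⁻ t, φ (y - t) * g t ∂μ) ^ s ∂μ) ^ (1 / s)
      ≤ (∫⁻ y, A ^ (s - 1) * ∫⁻ t, φ (y - t) * g t ^ s ∂μ ∂μ) ^ (1 / s) :=
        ENNReal.rpow_le_rpow (lintegral_mono holder) (by positivity)
    _ = (A ^ s * ∫⁻ t, g t ^ s ∂μ) ^ (1 / s) := by
        rw [lintegral_const_mul, key _ (by fun_prop), ← mul_assoc]
        · congr 2
          nth_rewrite 2 [← ENNReal.rpow_one A]
          rw [← ENNReal.rpow_add_of_nonneg _ _ hs1.le zero_le_one, sub_add_cancel]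
        · exact Measurable.lintegral_prod_right' (f := fun z : G × G => φ (z.1 - z.2) * g z.2 ^ s)
            (by fun_prop)
    _ = A * (∫⁻ t, g t ^ s ∂μ) ^ (1 / s) := by
        rw [ENNReal.mul_rpow_of_nonneg _ _ (by positivity), ← ENNReal.rpow_mul,
          mul_one_div_cancel hp0.ne', ENNReal.rpow_one]

/-! ### Power bumps in `L^p(dr/r)` -/

/-- A profile decaying like a small power at `0` and at `∞`. -/
def powerBump (ε r : ℝ) : ℝ := min (r ^ ε) (r ^ (-ε))

theorem measurable_powerBump (ε : ℝ) : Measurable (powerBump ε) := by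
  unfold powerBump; fun_prop

theorem powerBump_nonneg {ε r : ℝ} (hr : 0 ≤ r) : 0 ≤ powerBump ε r :=
  le_min (Real.rpow_nonneg hr _) (Real.rpow_nonneg hr _)

theorem powerBump_le_one {ε r : ℝ} (hε : 0 ≤ ε) (hr : 0 ≤ r) : powerBump ε r ≤ 1 := by
  rcases le_total r 1 with h | h
  · exact (min_le_left _ _).trans (Real.rpow_le_one hr h hε)
  · exact (min_le_right _ _).trans (Real.rpow_le_one_of_one_le_of_nonpos h (by linarith))

theorem lintegral_haarPos (f : ℝ → ℝ≥0∞) (hf : Measurable f) :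
    ∫⁻ r, f r ∂haarPos = ∫⁻ r in Ioi (0 : ℝ), ENNReal.ofReal r⁻¹ * f r := by
  unfold haarPos
  rw [lintegral_withDensity_eq_lintegral_mul _ (by fun_prop) hf]
  rfl

theorem ae_haarPos_pos : ∀ᵐ r ∂haarPos, 0 < r := by
  unfold haarPos
  exact (withDensity_absolutelyContinuous _ _).ae_le (ae_restrict_mem measurableSet_Ioi)

theorem lintegral_powerBump_haarPos_le {ε l : ℝ} (hε : 0 < ε) (hl : 0 < l) :
    ∫⁻ r, ENNReal.ofReal (powerBump ε (l * r)) ∂haarPos ≤ ENNReal.ofReal (2 / ε) := by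
  have hm : Measurable fun r => ENNReal.ofReal (powerBump ε (l * r)) :=
    ((measurable_powerBump ε).comp (measurable_const_mul l)).ennreal_ofReal
  rw [lintegral_haarPos _ hm]
  -- The two powers of `l * r` cross at `r = l⁻¹`; each side contributes `1 / ε`, whatever `l` is.
  have hsplit : Ioi (0 : ℝ) = Ioc 0 l⁻¹ ∪ Ioi l⁻¹ := by
    rw [Ioc_union_Ioi_eq_Ioi (by positivity)]
  rw [hsplit]
  refine (lintegral_union_le _ _ _).trans ?_
  have h1 : ∫⁻ r in Ioc 0 l⁻¹, ENNReal.ofReal r⁻¹ * ENNReal.ofReal (powerBump ε (l * r))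
      ≤ ENNReal.ofReal (1 / ε) := by
    calc _ ≤ ∫⁻ r in Ioc 0 l⁻¹, ENNReal.ofReal (l ^ ε * r ^ (ε - 1)) := by
          refine setLIntegral_mono (by fun_prop) fun r hr => ?_
          have hr0 : 0 < r := hr.1
          rw [← ENNReal.ofReal_mul (by positivity)]
          refine ENNReal.ofReal_le_ofReal ?_
          calc _ ≤ r⁻¹ * (l * r) ^ ε := by
                gcongr; exact min_le_left _ _
            _ = _ := by
                rw [Real.mul_rpow hl.le hr0.le, Real.rpow_sub_one hr0.ne']; ring
      _ = ENNReal.ofReal (∫ r in Ioc 0 l⁻¹, l ^ ε * r ^ (ε - 1)) := by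
          rw [ofReal_integral_eq_lintegral_ofReal]
          · refine Integrable.const_mul ?_ _
            have := intervalIntegral.intervalIntegrable_rpow' (a := 0) (b := l⁻¹)
              (show -1 < ε - 1 by linarith)
            rwa [intervalIntegrable_iff_integrableOn_Ioc_of_le (by positivity)] at this
          · filter_upwards [ae_restrict_mem measurableSet_Ioc] with r hr
            have hr0 : 0 < r := hr.1
            positivity
      _ = _ := by
          congr 1
          rw [← intervalIntegral.integral_of_le (by positivity),
            intervalIntegral.integral_const_mul, integral_rpow (by left; linarith)]
          rw [sub_add_cancel, Real.zero_rpow hε.ne', Real.inv_rpow hl.le]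
          have : 0 < l ^ ε := by positivity
          field_simp
          simp
  have h2 : ∫⁻ r in Ioi l⁻¹, ENNReal.ofReal r⁻¹ * ENNReal.ofReal (powerBump ε (l * r))
      ≤ ENNReal.ofReal (1 / ε) := by
    have hl' : 0 < l⁻¹ := by positivity
    calc _ ≤ ∫⁻ r in Ioi l⁻¹, ENNReal.ofReal (l ^ (-ε) * r ^ (-ε - 1)) := by
          refine setLIntegral_mono (by fun_prop) fun r hr => ?_
          have hr0 : 0 < r := hl'.trans hr
          rw [← ENNReal.ofReal_mul (by positivity)]
          refine ENNReal.ofReal_le_ofReal ?_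
          calc _ ≤ r⁻¹ * (l * r) ^ (-ε) := by
                gcongr; exact min_le_right _ _
            _ = _ := by
                rw [Real.mul_rpow hl.le hr0.le, Real.rpow_sub_one hr0.ne']; ring
      _ = ENNReal.ofReal (∫ r in Ioi l⁻¹, l ^ (-ε) * r ^ (-ε - 1)) := by
          rw [ofReal_integral_eq_lintegral_ofReal]
          · refine Integrable.const_mul ?_ _
            exact integrableOn_Ioi_rpow_of_lt (by linarith) hl'
          · filter_upwards [ae_restrict_mem measurableSet_Ioi] with r hr
            have hr0 : 0 < r := hl'.trans hr
            positivity
      _ = _ := by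
          congr 1
          rw [integral_const_mul, integral_Ioi_rpow_of_lt (by linarith) hl']
          rw [sub_add_cancel, Real.inv_rpow hl.le]
          have : 0 < l ^ (-ε) := by positivity
          field_simp
  refine (add_le_add h1 h2).trans ?_
  rw [← ENNReal.ofReal_add (by positivity) (by positivity)]
  exact ENNReal.ofReal_le_ofReal (le_of_eq (by ring))

/-- The bump is at most `1`, so its `p`-th power is at most itself and the `L¹` bound suffices. The
added `1` makes the base at least `1`, so the exponent `1/p` can be raised to `1`, and it also
covers `p = ∞`. -/
theorem eLpNorm_powerBump_haarPos_le {ε l : ℝ} (hε : 0 < ε) (hl : 0 < l) {p : ℝ≥0∞} (hp : 1 ≤ p) :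
    eLpNorm (fun r => ENNReal.ofReal (powerBump ε (l * r))) p haarPos ≤
      ENNReal.ofReal (2 / ε) + 1 := by
  have hle : ∀ᵐ r ∂haarPos, ENNReal.ofReal (powerBump ε (l * r)) ≤ 1 := by
    filter_upwards [ae_haarPos_pos] with r hr
    exact ENNReal.ofReal_le_one.2 (powerBump_le_one hε.le (by positivity))
  by_cases hpt : p = ⊤
  · subst hpt
    simp only [eLpNorm_exponent_top, eLpNormEssSup]
    refine essSup_le_of_ae_le _ ?_
    filter_upwards [hle] with r hr
    exact (show ‖ENNReal.ofReal (powerBump ε (l * r))‖ₑ ≤ 1 from hr).trans le_add_self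
  have hp0 : 0 < p.toReal := ENNReal.toReal_pos (by positivity) hpt
  have hp1 : 1 ≤ p.toReal := by
    rw [← ENNReal.toReal_one]; exact ENNReal.toReal_mono hpt hp
  rw [ENNReal.eLpNorm_eq_lintegral_rpow hp hpt]
  calc _ ≤ (ENNReal.ofReal (2 / ε) + 1) ^ (1 / p.toReal) := by
        refine ENNReal.rpow_le_rpow ?_ (by positivity)
        refine le_trans ?_ ((lintegral_powerBump_haarPos_le hε hl).trans le_self_add)
        refine lintegral_mono_ae ?_
        filter_upwards [hle] with r hr
        exact (ENNReal.rpow_le_rpow_of_exponent_ge hr hp1).trans (ENNReal.rpow_one _).le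
    _ ≤ (ENNReal.ofReal (2 / ε) + 1) ^ (1 : ℝ) :=
        ENNReal.rpow_le_rpow_of_exponent_le le_add_self ((div_le_one hp0).2 hp1)
    _ = _ := ENNReal.rpow_one _

/-! ### Dyadic differences and monomials -/

theorem exists_dyadicDiff_eq_sum (k : ℕ) :
    ∃ c : ℕ → ℝ, ∀ (F : ℝ → ℝ) (r : ℝ),
      dyadicDiff k F r = ∑ i ∈ Finset.range (k + 2), c i * F (r / 2 ^ i) := by
  induction k with
  | zero =>
    refine ⟨fun i => if i = 0 then 1 else -1, fun F r => ?_⟩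
    simp [dyadicDiff, Finset.sum_range_succ, sub_eq_add_neg]
  | succ k ih =>
    obtain ⟨c, hc⟩ := ih
    refine ⟨fun i => (if i < k + 2 then c i else 0) -
      (if i = 0 then 0 else 2 ^ (k + 1) * c (i - 1)), fun F r => ?_⟩
    simp only [sub_mul, Finset.sum_sub_distrib]
    rw [dyadicDiff, hc, hc]
    congr 1
    · rw [Finset.sum_range_succ (n := k + 2)]
      rw [if_neg (lt_irrefl _), zero_mul, add_zero]
      refine Finset.sum_congr rfl fun i hi => ?_
      rw [if_pos (Finset.mem_range.1 hi)]
    · rw [Finset.sum_range_succ' (n := k + 2)]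
      rw [if_pos rfl, zero_mul, add_zero]
      simp only [Nat.succ_ne_zero, if_false, Nat.add_sub_cancel]
      rw [Finset.mul_sum]
      refine Finset.sum_congr rfl fun i _ => ?_
      rw [pow_succ' 2 i, ← div_div, mul_assoc]

/-- Monomials are eigenfunctions of `F ↦ F(·/2)`, so each recursion step contributes one factor; the
factor `i = l` vanishes. -/
theorem dyadicDiff_pow (k l : ℕ) (r : ℝ) :
    dyadicDiff k (fun s => s ^ l) r
      = (∏ i ∈ Finset.range (k + 1), (1 - 2 ^ i / 2 ^ l)) * r ^ l := by
  induction k generalizing r with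
  | zero => simp [dyadicDiff, div_pow]; ring
  | succ k ih =>
    rw [dyadicDiff, ih, ih, Finset.prod_range_succ _ (k + 1), div_pow]
    ring

theorem dyadicDiff_pow_eq_zero {k l : ℕ} (h : l ≤ k) (r : ℝ) :
    dyadicDiff k (fun s => s ^ l) r = 0 := by
  rw [dyadicDiff_pow, Finset.prod_eq_zero (i := l), zero_mul]
  · simpa [Nat.lt_succ_iff] using h
  · simp

/-! ### Dyadic differences of ball masses as convolutions -/

/-- The radial step function `∑ c_i 1_{|x| ≤ r / 2^i}`. -/
def shellSum (d : ℕ) (c : ℕ → ℝ) (n : ℕ) (r : ℝ) (x : EuclideanSpace ℝ (Fin d)) : ℂ :=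
  ∑ i ∈ Finset.range n, (c i : ℂ) * (Metric.closedBall 0 (r / 2 ^ i)).indicator (fun _ => 1) x

/-- The convolution of a radial step function with a function on `ℝ^d`. -/
def shellConv {d : ℕ} (c : ℕ → ℝ) (n : ℕ) (r : ℝ) (g : EuclideanSpace ℝ (Fin d) → ℂ)
    (x : EuclideanSpace ℝ (Fin d)) : ℂ :=
  ∫ t, shellSum d c n r t * g (x - t)

section
variable {d : ℕ} (c : ℕ → ℝ) (n : ℕ) (r : ℝ)

theorem measurable_shellSum : Measurable (shellSum d c n r) := by
  unfold shellSum
  refine Finset.measurable_sum _ fun i _ => measurable_const.mul ?_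
  exact measurable_const.indicator Metric.isClosed_closedBall.measurableSet

theorem integrable_shellSum : Integrable (shellSum d c n r) := by
  unfold shellSum
  refine integrable_finsetSum _ fun i _ => Integrable.const_mul ?_ _
  refine (integrable_indicator_iff Metric.isClosed_closedBall.measurableSet).2 ?_
  exact integrableOn_const (isCompact_closedBall _ _).measure_lt_top.ne

theorem norm_shellSum_le (x : EuclideanSpace ℝ (Fin d)) :
    ‖shellSum d c n r x‖ ≤ ∑ i ∈ Finset.range n, |c i| := by
  unfold shellSum
  refine (norm_sum_le _ _).trans (Finset.sum_le_sum fun i _ => ?_)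
  rw [norm_mul, Complex.norm_real, Real.norm_eq_abs]
  refine mul_le_of_le_one_right (abs_nonneg _) ?_
  by_cases h : x ∈ Metric.closedBall 0 (r / 2 ^ i) <;> simp [h]

theorem shellConv_eq_sum {g : EuclideanSpace ℝ (Fin d) → ℂ} (hg : Integrable g)
    (x : EuclideanSpace ℝ (Fin d)) :
    shellConv c n r g x
      = ∑ i ∈ Finset.range n, (c i : ℂ) * ∫ t in Metric.closedBall 0 (r / 2 ^ i), g (x - t) := by
  unfold shellConv shellSum
  simp_rw [Finset.sum_mul]
  rw [integral_finsetSum]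
  · refine Finset.sum_congr rfl fun i _ => ?_
    simp_rw [mul_assoc]
    rw [integral_const_mul, ← integral_indicator Metric.isClosed_closedBall.measurableSet]
    congr 2 with t
    by_cases h : t ∈ Metric.closedBall 0 (r / 2 ^ i) <;> simp [h]
  · intro i _
    have h := (hg.comp_sub_left x).bdd_mul (c := |c i|)
      (f := fun t => (c i : ℂ) * (Metric.closedBall 0 (r / 2 ^ i)).indicator (fun _ => 1) t)
      ?_ ?_
    · exact h
    · exact (measurable_const.mul (measurable_const.indicator
        Metric.isClosed_closedBall.measurableSet)).aestronglyMeasurable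
    · refine Filter.Eventually.of_forall fun t => ?_
      rw [norm_mul, Complex.norm_real, Real.norm_eq_abs]
      refine mul_le_of_le_one_right (abs_nonneg _) ?_
      by_cases h : t ∈ Metric.closedBall 0 (r / 2 ^ i) <;> simp [h]

theorem setIntegral_closedBall_sub_left (f : EuclideanSpace ℝ (Fin d) → ℝ)
    (y : EuclideanSpace ℝ (Fin d)) (s : ℝ) :
    ∫ t in Metric.closedBall 0 s, f (y - t) = ∫ x in Metric.closedBall y s, f x := by
  rw [← integral_indicator Metric.isClosed_closedBall.measurableSet,
    ← integral_indicator Metric.isClosed_closedBall.measurableSet,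
    ← integral_sub_left_eq_self _ volume y]
  congr 1 with t
  simp [indicator, Metric.mem_closedBall, dist_eq_norm, norm_sub_rev]

end

/-- The ball mass is `f` convolved with the indicator of a centred ball. Complex values are used
because the blocks of a real `f` may be complex: `χ` need not be even. -/
theorem ofReal_dyadicDiff_ballMass {d : ℕ} {k : ℕ} {c : ℕ → ℝ}
    (hc : ∀ (F : ℝ → ℝ) (r : ℝ),
      dyadicDiff k F r = ∑ i ∈ Finset.range (k + 2), c i * F (r / 2 ^ i))
    {f : EuclideanSpace ℝ (Fin d) → ℝ} (hf : Integrable f) (r : ℝ)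
    (y : EuclideanSpace ℝ (Fin d)) :
    ((dyadicDiff k (fun s => ballMass (volume.withDensityᵥ f) s y) r : ℝ) : ℂ)
      = shellConv c (k + 2) r (fun x => (f x : ℂ)) y := by
  have hfc : Integrable fun x => (f x : ℂ) := hf.ofReal
  rw [hc, shellConv_eq_sum _ _ _ hfc]
  push_cast
  refine Finset.sum_congr rfl fun i _ => ?_
  rw [ballMass, withDensityᵥ_apply hf Metric.isClosed_closedBall.measurableSet,
    integral_complex_ofReal, setIntegral_closedBall_sub_left]

/-! ### Step functions against Schwartz functions -/

section
variable {d : ℕ}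

theorem SchwartzMap.exists_norm_iteratedFDeriv_le (ψ : SchwartzMap (EuclideanSpace ℝ (Fin d)) ℂ)
    (n : ℕ) (γ : ℝ) :
    ∃ C : ℝ, 0 ≤ C ∧ ∀ x, ‖iteratedFDeriv ℝ n ψ x‖ ≤ C * (1 + ‖x‖) ^ (-γ) := by
  refine ⟨2 ^ ⌈γ⌉₊ * (Finset.Iic (⌈γ⌉₊, n)).sup (fun m => SchwartzMap.seminorm ℝ m.1 m.2) ψ,
    by positivity, fun x => ?_⟩
  have h := SchwartzMap.one_add_le_sup_seminorm_apply (𝕜 := ℝ) (m := (⌈γ⌉₊, n)) le_rfl le_rfl ψ x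
  have hx : 1 ≤ 1 + ‖x‖ := by linarith [norm_nonneg x]
  rw [Real.rpow_neg (by positivity), ← div_eq_mul_inv, le_div_iff₀ (by positivity), mul_comm]
  refine le_trans ?_ h
  gcongr
  rw [← Real.rpow_natCast]
  exact Real.rpow_le_rpow_of_exponent_le hx (Nat.le_ceil γ)

theorem norm_iteratedDeriv_comp_line_le {ψ : EuclideanSpace ℝ (Fin d) → ℂ} {n : ℕ}
    (hψ : ContDiff ℝ n ψ) (x w : EuclideanSpace ℝ (Fin d)) (s : ℝ) :
    ‖iteratedDeriv n (fun s : ℝ => ψ (x - s • w)) s‖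
      ≤ ‖iteratedFDeriv ℝ n ψ (x - s • w)‖ * ‖w‖ ^ n := by
  set L : ℝ →L[ℝ] EuclideanSpace ℝ (Fin d) := ContinuousLinearMap.toSpanSingleton ℝ (-w)
  have hL : ∀ s, L s = -(s • w) := fun s => by simp [L]
  have e : (fun s : ℝ => ψ (x - s • w)) = (fun z => ψ (x + z)) ∘ L := by
    ext s; simp [hL, sub_eq_add_neg]
  have hLn : ‖L‖ = ‖w‖ := by simp [L]
  have hg : ContDiff ℝ n fun z => ψ (x + z) := hψ.comp (by fun_prop)
  rw [← norm_iteratedFDeriv_eq_norm_iteratedDeriv, e, L.iteratedFDeriv_comp_right hg s le_rfl]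
  refine (ContinuousMultilinearMap.norm_compContinuousLinearMap_le _ _).trans ?_
  rw [iteratedFDeriv_comp_add_left, hL, ← sub_eq_add_neg]
  simp [hLn]

theorem one_add_norm_le_mul (x w : EuclideanSpace ℝ (Fin d)) :
    1 + ‖x‖ ≤ (1 + ‖w‖) * (1 + ‖x - w‖) := by
  have h : ‖x‖ ≤ ‖w‖ + ‖x - w‖ := by simpa using norm_add_le w (x - w)
  nlinarith [norm_nonneg w, norm_nonneg (x - w)]

/-- Peetre's inequality: `1 + ‖·‖` is submultiplicative, so a bounded shift of a polynomial weight
costs only a constant. -/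
theorem rpow_neg_one_add_norm_sub_le {γ R : ℝ} (hγ : 0 ≤ γ) {x w : EuclideanSpace ℝ (Fin d)}
    (hw : ‖w‖ ≤ R) :
    (1 + ‖x - w‖) ^ (-γ) ≤ (1 + R) ^ γ * (1 + ‖x‖) ^ (-γ) := by
  have hR : 0 ≤ R := (norm_nonneg w).trans hw
  rw [Real.rpow_neg (by positivity), Real.rpow_neg (by positivity), ← div_eq_mul_inv,
    le_div_iff₀ (by positivity), inv_mul_le_iff₀ (by positivity),
    ← Real.mul_rpow (by positivity) (by positivity)]
  refine Real.rpow_le_rpow (by positivity) ?_ hγ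
  calc _ ≤ _ := one_add_norm_le_mul x w
    _ ≤ (1 + ‖x - w‖) * (1 + R) := by rw [mul_comm]; gcongr

/-- Moves all radii to one domain. The Jacobian `s^d` raises the degree of every Taylor term by `d`,
which is why moments up to `d + m` must vanish. -/
theorem setIntegral_closedBall_eq_unit (g : EuclideanSpace ℝ (Fin d) → ℂ) {s : ℝ} (hs : 0 < s) :
    ∫ t in Metric.closedBall 0 s, g t
      = (s : ℂ) ^ d * ∫ w in Metric.closedBall 0 1, g (s • w) := by
  rw [Measure.setIntegral_comp_smul_of_pos _ _ _ hs, smul_unitClosedBall_of_nonneg hs.le,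
    finrank_euclideanSpace_fin, Complex.real_smul]
  push_cast
  rw [mul_inv_cancel_left₀ (by exact_mod_cast (pow_pos hs d).ne')]

/-- A smooth function on `[0, 1]`, weighted by `s^d` and sampled along a scheme annihilating the
monomials of degree at most `d + m`, is of the size of its Taylor remainder. -/
theorem norm_sum_pow_mul_le {c : ℕ → ℝ} {n m : ℕ}
    (hc : ∀ l ≤ d + m, ∀ r : ℝ, ∑ i ∈ Finset.range n, c i * (r / 2 ^ i) ^ l = 0)
    {u : ℝ → ℂ} (hu : ContDiff ℝ (m + 1 : ℕ) u) {B : ℝ}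
    (hB : ∀ s ∈ Icc (0 : ℝ) 1, ‖iteratedDeriv (m + 1) u s‖ ≤ B) {r : ℝ} (hr : 0 < r) (hr1 : r ≤ 1) :
    ‖∑ i ∈ Finset.range n, (c i : ℂ) * (((r / 2 ^ i : ℝ) : ℂ) ^ d * u (r / 2 ^ i))‖
      ≤ (∑ i ∈ Finset.range n, |c i|) * B * r ^ (d + m + 1) := by
  set T : ℝ → ℂ := taylorWithinEval u m (Icc 0 1) 0 with hT
  have hs : ∀ i : ℕ, 0 < r / 2 ^ i ∧ r / 2 ^ i ≤ r := fun i =>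
    ⟨by positivity, div_le_self hr.le (one_le_pow₀ one_le_two)⟩
  have hB0 : 0 ≤ B := (norm_nonneg _).trans (hB 0 (by simp))
  -- The Taylor term of degree `l ≤ m` times `s^d` is a monomial of degree `d + l ≤ d + m`, which
  -- the scheme annihilates.
  have hzero : ∑ i ∈ Finset.range n, (c i : ℂ) * (((r / 2 ^ i : ℝ) : ℂ) ^ d * T (r / 2 ^ i)) = 0 := by
    simp only [hT, taylor_within_apply, Finset.mul_sum]
    rw [Finset.sum_comm]
    refine Finset.sum_eq_zero fun l hl => ?_
    have h := hc (d + l) (by have := Finset.mem_range.1 hl; omega) r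
    have h' : ∑ i ∈ Finset.range n, (c i : ℂ) * ((r / 2 ^ i : ℝ) : ℂ) ^ (d + l) = 0 := by
      exact_mod_cast h
    calc _ = (∑ i ∈ Finset.range n, (c i : ℂ) * ((r / 2 ^ i : ℝ) : ℂ) ^ (d + l)) *
          (((l.factorial : ℂ))⁻¹ * iteratedDerivWithin l u (Icc 0 1) 0) := by
          rw [Finset.sum_mul]
          refine Finset.sum_congr rfl fun i _ => ?_
          rw [sub_zero, Complex.real_smul]
          push_cast
          ring
      _ = 0 := by rw [h', zero_mul]
  have hrem : ∀ i : ℕ, ‖u (r / 2 ^ i) - T (r / 2 ^ i)‖ ≤ B * r ^ (m + 1) := by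
    intro i
    have hmem : r / 2 ^ i ∈ Icc (0 : ℝ) 1 := ⟨(hs i).1.le, (hs i).2.trans hr1⟩
    have h := taylor_mean_remainder_bound (f := u) (n := m) (C := B) zero_le_one
      (by exact_mod_cast hu.contDiffOn) hmem (fun y hy => by
        rw [iteratedDerivWithin_eq_iteratedDeriv (uniqueDiffOn_Icc zero_lt_one)
          hu.contDiffAt hy]
        exact hB y hy)
    refine h.trans ?_
    rw [sub_zero]
    refine (div_le_self (by positivity) (by exact_mod_cast m.factorial_pos)).trans ?_
    gcongr
    exact (hs i).2
  rw [← sub_zero (∑ i ∈ _, _), ← hzero, ← Finset.sum_sub_distrib, Finset.sum_mul, Finset.sum_mul]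
  refine (norm_sum_le _ _).trans (Finset.sum_le_sum fun i _ => ?_)
  rw [← mul_sub, ← mul_sub, norm_mul, norm_mul, norm_pow, Complex.norm_real, Complex.norm_real,
    Real.norm_eq_abs, Real.norm_of_nonneg (hs i).1.le]
  calc _ ≤ |c i| * (r ^ d * (B * r ^ (m + 1))) := by
        gcongr
        · exact (hs i).2
        · exact hrem i
    _ = _ := by ring

/-- On the unit ball, for fixed `w`, the integrand is the scheme applied to `s^d ψ(x - s w)`, so
only a Taylor remainder in `s` survives. Shifts have length at most `1`, whence the factor `2 ^ γ`.
-/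
theorem exists_norm_shellConv_le_small {c : ℕ → ℝ} {n m : ℕ}
    (hc : ∀ l ≤ d + m, ∀ r : ℝ, ∑ i ∈ Finset.range n, c i * (r / 2 ^ i) ^ l = 0)
    (ψ : SchwartzMap (EuclideanSpace ℝ (Fin d)) ℂ) {γ : ℝ} (hγ : 0 ≤ γ) :
    ∃ C : ℝ, 0 ≤ C ∧ ∀ x r, 0 < r → r ≤ 1 →
      ‖shellConv c n r ψ x‖ ≤ C * r ^ (d + m + 1) * (1 + ‖x‖) ^ (-γ) := by
  obtain ⟨A, hA0, hA⟩ := ψ.exists_norm_iteratedFDeriv_le (m + 1) γ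
  set V : ℝ := volume.real (Metric.closedBall (0 : EuclideanSpace ℝ (Fin d)) 1)
  refine ⟨(∑ i ∈ Finset.range n, |c i|) * (A * 2 ^ γ) * V, by positivity, fun x r hr hr1 => ?_⟩
  have hs : ∀ i : ℕ, 0 < r / 2 ^ i := fun i => by positivity
  have e : shellConv c n r ψ x = ∫ w in Metric.closedBall (0 : EuclideanSpace ℝ (Fin d)) 1,
      ∑ i ∈ Finset.range n,
        (c i : ℂ) * (((r / 2 ^ i : ℝ) : ℂ) ^ d * ψ (x - (r / 2 ^ i) • w)) := by
    rw [shellConv_eq_sum _ _ _ ψ.integrable, integral_finsetSum]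
    · refine Finset.sum_congr rfl fun i _ => ?_
      rw [setIntegral_closedBall_eq_unit (fun t => ψ (x - t)) (hs i), integral_const_mul,
        integral_const_mul]
    · intro i _
      have := ψ.continuous
      exact (by fun_prop : Continuous _).continuousOn.integrableOn_compact
        (isCompact_closedBall _ _)
  rw [e]
  have hbound : ∀ w ∈ Metric.closedBall (0 : EuclideanSpace ℝ (Fin d)) 1,
      ‖∑ i ∈ Finset.range n,
        (c i : ℂ) * (((r / 2 ^ i : ℝ) : ℂ) ^ d * ψ (x - (r / 2 ^ i) • w))‖
      ≤ (∑ i ∈ Finset.range n, |c i|) * (A * 2 ^ γ * (1 + ‖x‖) ^ (-γ)) * r ^ (d + m + 1) := by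
    intro w hw
    have hw1 : ‖w‖ ≤ 1 := by simpa using hw
    have hψ : ContDiff ℝ (m + 1 : ℕ) ψ := ψ.smooth _
    refine norm_sum_pow_mul_le hc (u := fun s => ψ (x - s • w)) (hψ.comp (by fun_prop)) ?_ hr hr1
    intro s hs
    refine (norm_iteratedDeriv_comp_line_le hψ x w s).trans ?_
    have hsw : ‖s • w‖ ≤ 1 := by
      rw [norm_smul, Real.norm_of_nonneg hs.1]
      exact mul_le_one₀ hs.2 (norm_nonneg _) hw1
    calc _ ≤ (A * (1 + ‖x - s • w‖) ^ (-γ)) * 1 := by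
          gcongr
          · exact hA _
          · exact pow_le_one₀ (norm_nonneg _) hw1
      _ ≤ (A * ((1 + 1) ^ γ * (1 + ‖x‖) ^ (-γ))) * 1 := by
          gcongr
          exact rpow_neg_one_add_norm_sub_le hγ hsw
      _ = _ := by norm_num; ring
  refine (norm_setIntegral_le_of_norm_le_const
    (isCompact_closedBall _ _).measure_lt_top hbound).trans (le_of_eq ?_)
  ring

/-- No cancellation is needed. Of the decay `γ + (d + 1)` of `ψ`, the part `γ` is transferred from
`x - t` to `x` at cost `(1 + r)^γ ≤ (2r)^γ`, and the part `d + 1` is integrable in `t`. -/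
theorem exists_norm_shellConv_le_large (c : ℕ → ℝ) (n : ℕ)
    (ψ : SchwartzMap (EuclideanSpace ℝ (Fin d)) ℂ) {γ : ℝ} (hγ : 0 ≤ γ) :
    ∃ C : ℝ, 0 ≤ C ∧ ∀ x r, 1 ≤ r →
      ‖shellConv c n r ψ x‖ ≤ C * r ^ γ * (1 + ‖x‖) ^ (-γ) := by
  obtain ⟨A, hA0, hA⟩ := ψ.exists_norm_iteratedFDeriv_le 0 (γ + (d + 1))
  set J : ℝ := ∫ z : EuclideanSpace ℝ (Fin d), (1 + ‖z‖) ^ (-((d : ℝ) + 1))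
  have hJint : Integrable fun z : EuclideanSpace ℝ (Fin d) => (1 + ‖z‖) ^ (-((d : ℝ) + 1)) :=
    integrable_one_add_norm (by simp)
  have hJ : 0 ≤ J := integral_nonneg fun z => by positivity
  refine ⟨(∑ i ∈ Finset.range n, |c i|) * (A * 2 ^ γ * J), by positivity, fun x r hr => ?_⟩
  have hr0 : 0 < r := by linarith
  rw [shellConv_eq_sum _ _ _ ψ.integrable, Finset.sum_mul, Finset.sum_mul, Finset.sum_mul]
  refine (norm_sum_le _ _).trans (Finset.sum_le_sum fun i _ => ?_)
  rw [norm_mul, Complex.norm_real, Real.norm_eq_abs, mul_assoc, mul_assoc]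
  refine mul_le_mul_of_nonneg_left ?_ (abs_nonneg _)
  have hs : r / 2 ^ i ≤ r := div_le_self hr0.le (one_le_pow₀ one_le_two)
  set D : ℝ := A * ((1 + r) ^ γ * (1 + ‖x‖) ^ (-γ))
  calc ‖∫ t in Metric.closedBall 0 (r / 2 ^ i), ψ (x - t)‖
      ≤ ∫ t in Metric.closedBall 0 (r / 2 ^ i), D * (1 + ‖x - t‖) ^ (-((d : ℝ) + 1)) := by
        refine norm_integral_le_of_norm_le ((hJint.comp_sub_left x).const_mul _).integrableOn ?_
        filter_upwards [ae_restrict_mem Metric.isClosed_closedBall.measurableSet] with t ht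
        have ht' : ‖t‖ ≤ r := le_trans (by simpa using ht) hs
        have h := hA (x - t)
        rw [norm_iteratedFDeriv_zero, neg_add, Real.rpow_add (by positivity)] at h
        refine h.trans ?_
        rw [← mul_assoc]
        refine mul_le_mul_of_nonneg_right (mul_le_mul_of_nonneg_left ?_ hA0) (by positivity)
        exact rpow_neg_one_add_norm_sub_le hγ ht'
    _ ≤ ∫ t, D * (1 + ‖x - t‖) ^ (-((d : ℝ) + 1)) :=
        setIntegral_le_integral ((hJint.comp_sub_left x).const_mul _)
          (Filter.Eventually.of_forall fun t => by positivity)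
    _ = D * J := by
        rw [integral_const_mul, integral_sub_left_eq_self
          (fun z : EuclideanSpace ℝ (Fin d) => (1 + ‖z‖) ^ (-((d : ℝ) + 1)))]
    _ ≤ A * ((2 * r) ^ γ * (1 + ‖x‖) ^ (-γ)) * J := by
        refine mul_le_mul_of_nonneg_right (mul_le_mul_of_nonneg_left ?_ hA0) hJ
        gcongr
        linarith
    _ = _ := by rw [Real.mul_rpow (by norm_num) hr0.le]; ring

/-- The weight exponent `γ = d + α/2` exceeds `d`, for integrability, yet stays at most `α + d - ε`,
for decay at large `r`. At small `r`, `ε ≤ m + 1 - α` gives `r^{d+m+1} ≤ r^{α+d+ε}`. -/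
theorem exists_norm_shellConv_le {c : ℕ → ℝ} {n m : ℕ}
    (hc : ∀ l ≤ d + m, ∀ r : ℝ, ∑ i ∈ Finset.range n, c i * (r / 2 ^ i) ^ l = 0)
    (ψ : SchwartzMap (EuclideanSpace ℝ (Fin d)) ℂ) {α ε : ℝ} (hα : 0 < α)
    (hε0 : 0 ≤ ε) (hε1 : ε ≤ m + 1 - α) (hε2 : ε ≤ α / 2) :
    ∃ C : ℝ, 0 ≤ C ∧ ∀ x r, 0 < r →
      ‖shellConv c n r ψ x‖
        ≤ C * r ^ (α + d) * powerBump ε r * (1 + ‖x‖) ^ (-((d : ℝ) + α / 2)) := by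
  have hγ : 0 ≤ (d : ℝ) + α / 2 := by positivity
  obtain ⟨C₁, h10, h1⟩ := exists_norm_shellConv_le_small hc ψ hγ
  obtain ⟨C₂, h20, h2⟩ := exists_norm_shellConv_le_large c n ψ hγ
  refine ⟨C₁ + C₂, by positivity, fun x r hr => ?_⟩
  have key : ∀ {C : ℝ} {s : ℝ}, 0 ≤ C → C ≤ C₁ + C₂ → 0 ≤ s → s ≤ r ^ (α + d) * powerBump ε r →
      C * s * (1 + ‖x‖) ^ (-((d : ℝ) + α / 2)) ≤
      (C₁ + C₂) * r ^ (α + d) * powerBump ε r * (1 + ‖x‖) ^ (-((d : ℝ) + α / 2)) := by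
    intro C s h0 hC hs0 hs
    rw [mul_assoc (C₁ + C₂)]
    gcongr
  have hmin : r ^ (α + d) * powerBump ε r = min (r ^ (α + d + ε)) (r ^ (α + d - ε)) := by
    rw [powerBump, mul_min_of_nonneg _ _ (by positivity), ← Real.rpow_add hr, ← Real.rpow_add hr,
      sub_eq_add_neg]
  rcases le_total r 1 with hr1 | hr1
  · refine (h1 x r hr hr1).trans (key h10 (by linarith) (by positivity) ?_)
    rw [hmin, ← Real.rpow_natCast]
    push_cast
    refine le_min ?_ ?_ <;> refine Real.rpow_le_rpow_of_exponent_ge hr hr1 ?_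
    · linarith
    · linarith
  · refine (h2 x r hr1).trans (key h20 (by linarith) (by positivity) ?_)
    rw [hmin]
    refine le_min ?_ ?_ <;> refine Real.rpow_le_rpow_of_exponent_le hr1 ?_
    · linarith
    · linarith

end

/-! ### Littlewood–Paley kernels: reproduction and scaling -/

namespace FrequencyCutoff
variable {d : ℕ} (χ : FrequencyCutoff d)

/-- The dilated cutoff `χ(2^{-j} ξ)` as a Schwartz function. -/
def dilatedCutoff (j : ℕ) : SchwartzMap (EuclideanSpace ℝ (Fin d)) ℂ :=
  HasCompactSupport.toSchwartzMap (f := fun ξ => (χ.toFun (((2 : ℝ) ^ j)⁻¹ • ξ) : ℂ))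
    (by
      refine HasCompactSupport.intro (isCompact_closedBall 0 (2 * 2 ^ j)) fun ξ hξ => ?_
      rw [χ.eq_zero, Complex.ofReal_zero]
      have h : 2 * 2 ^ j < ‖ξ‖ := by simpa using hξ
      rw [norm_smul, norm_inv, norm_pow, Real.norm_ofNat, inv_mul_eq_div,
        le_div_iff₀ (by positivity)]
      exact h.le)
    (Complex.ofRealCLM.contDiff.comp (χ.smooth.comp (contDiff_const_smul _)))

theorem dilatedCutoff_apply (j : ℕ) (ξ : EuclideanSpace ℝ (Fin d)) :
    χ.dilatedCutoff j ξ = (χ.toFun (((2 : ℝ) ^ j)⁻¹ • ξ) : ℂ) := rfl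

/-- The kernel of the `j`-th low-pass filter. -/
def lowPass (j : ℕ) : SchwartzMap (EuclideanSpace ℝ (Fin d)) ℂ := 𝓕⁻ (χ.dilatedCutoff j)

/-- The `j`-th symbol as a Schwartz function. -/
def symbolSchwartz : ℕ → SchwartzMap (EuclideanSpace ℝ (Fin d)) ℂ
  | 0 => χ.dilatedCutoff 0
  | j + 1 => χ.dilatedCutoff (j + 1) - χ.dilatedCutoff j

theorem symbolSchwartz_apply (j : ℕ) (ξ : EuclideanSpace ℝ (Fin d)) :
    χ.symbolSchwartz j ξ = (χ.symbol j ξ : ℂ) := by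
  cases j with
  | zero => simp [symbolSchwartz, symbol, dilatedCutoff_apply]
  | succ j => simp [symbolSchwartz, symbol, dilatedCutoff_apply]

theorem kernel_eq (j : ℕ) : χ.kernel j = 𝓕⁻ (χ.symbolSchwartz j) := by
  rw [kernel, SchwartzMap.fourierInv_coe]
  congr 1
  ext ξ
  rw [symbolSchwartz_apply]

theorem kernel_zero : χ.kernel 0 = χ.lowPass 0 := χ.kernel_eq 0

theorem kernel_succ (j : ℕ) : χ.kernel (j + 1) = fun x => χ.lowPass (j + 1) x - χ.lowPass j x := by
  have h : 𝓕⁻ (χ.dilatedCutoff (j + 1) - χ.dilatedCutoff j)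
      = χ.lowPass (j + 1) - χ.lowPass j :=
    map_sub (FourierTransform.fourierInvCLM ℂ (SchwartzMap (EuclideanSpace ℝ (Fin d)) ℂ)) _ _
  rw [kernel_eq, symbolSchwartz, h]
  rfl

/-- The `j`-th symbol vanishes for `‖ξ‖ ≥ 2^{j+1}`, and the dilated cutoff of index `j + 1` equals
`1` for `‖ξ‖ ≤ 2^{j+1}`. -/
theorem dilatedCutoff_succ_mul_symbol (j : ℕ) (ξ : EuclideanSpace ℝ (Fin d)) :
    χ.dilatedCutoff (j + 1) ξ * χ.symbolSchwartz j ξ = χ.symbolSchwartz j ξ := by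
  have hn : ∀ i : ℕ, ‖((2 : ℝ) ^ i)⁻¹ • ξ‖ = ‖ξ‖ / 2 ^ i := fun i => by
    rw [norm_smul, norm_inv, norm_pow, Real.norm_ofNat, inv_mul_eq_div]
  rcases le_total ‖ξ‖ (2 ^ (j + 1)) with h | h
  · rw [dilatedCutoff_apply, χ.eq_one, Complex.ofReal_one, one_mul]
    rwa [hn, div_le_one (by positivity)]
  · have hz : ∀ i ≤ j, χ.dilatedCutoff i ξ = 0 := by
      intro i hi
      rw [dilatedCutoff_apply, χ.eq_zero, Complex.ofReal_zero]
      rw [hn, le_div_iff₀ (by positivity)]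
      refine le_trans ?_ h
      rw [pow_succ']
      gcongr
      exact one_le_two
    cases j with
    | zero => simp [symbolSchwartz, hz 0 le_rfl]
    | succ j =>
      have hz' : χ.symbolSchwartz (j + 1) ξ = 0 := by
        simp [symbolSchwartz, hz (j + 1) le_rfl, hz j (Nat.le_succ j)]
      rw [hz', mul_zero]

open ContinuousLinearMap in
/-- The next low-pass filter reproduces a Littlewood–Paley kernel. -/
theorem lowPass_convolution_kernel (j : ℕ) :
    convolution (χ.lowPass (j + 1)) (χ.kernel j) (mul ℂ ℂ) volume = χ.kernel j := by
  have h : SchwartzMap.convolution (mul ℂ ℂ) (χ.lowPass (j + 1)) (𝓕⁻ (χ.symbolSchwartz j))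
      = 𝓕⁻ (χ.symbolSchwartz j) := by
    rw [← FourierTransform.fourierInv_fourier_eq (F := SchwartzMap (EuclideanSpace ℝ (Fin d)) ℂ)
      (SchwartzMap.convolution (mul ℂ ℂ)
      (χ.lowPass (j + 1)) (𝓕⁻ (χ.symbolSchwartz j)))]
    congr 1
    ext ξ
    rw [SchwartzMap.fourier_convolution, SchwartzMap.pairing_apply_apply, lowPass, FourierTransform.fourier_fourierInv_eq,
      FourierTransform.fourier_fourierInv_eq]
    exact χ.dilatedCutoff_succ_mul_symbol j ξ
  rw [kernel_eq]
  ext x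
  conv_rhs => rw [← h]
  rw [SchwartzMap.convolution_apply]

theorem lowPass_apply (j : ℕ) (x : EuclideanSpace ℝ (Fin d)) :
    χ.lowPass j x = ((2 : ℂ) ^ j) ^ d * χ.lowPass 0 ((2 : ℝ) ^ j • x) := by
  have e : ∀ j x, χ.lowPass j x
      = ∫ v, Real.fourierChar (inner ℝ v x) • χ.dilatedCutoff j v := by
    intro j x
    rw [lowPass, SchwartzMap.fourierInv_coe, Real.fourierInv_eq]
  rw [e, e]
  obtain ⟨g, hgd⟩ : ∃ g : EuclideanSpace ℝ (Fin d) → ℂ, g =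
    fun u => Real.fourierChar (inner ℝ u ((2 : ℝ) ^ j • x)) • χ.dilatedCutoff 0 u := ⟨_, rfl⟩
  have hg : ∀ v, Real.fourierChar (inner ℝ v x) • χ.dilatedCutoff j v
      = g (((2 : ℝ) ^ j)⁻¹ • v) := by
    intro v
    simp only [hgd, dilatedCutoff_apply, inner_smul_left, inner_smul_right]
    simp
  simp_rw [hg, ← hgd]
  rw [Measure.integral_comp_smul, finrank_euclideanSpace_fin, Complex.real_smul,
    abs_of_nonneg (by positivity)]
  congr 1
  push_cast
  rw [inv_pow, inv_inv]

/-- The integral is the Fourier transform at `0`, namely `χ(0)`. This makes the low-pass kernels an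
approximate identity. -/
theorem integral_lowPass_zero : ∫ x, χ.lowPass 0 x = 1 := by
  have h : (𝓕 (χ.lowPass 0)) 0 = ∫ x, χ.lowPass 0 x := by
    rw [SchwartzMap.fourier_coe, Real.fourier_eq]
    simp
  rw [← h, lowPass, FourierTransform.fourier_fourierInv_eq, dilatedCutoff_apply, χ.eq_one]
  · simp
  · simp

/-- Step functions are invariant under dilating `r` and `x` together, so a single estimate for
`lowPass 0` serves every `j`. -/
theorem shellConv_lowPass (c : ℕ → ℝ) (n : ℕ) (r : ℝ) (j : ℕ) (x : EuclideanSpace ℝ (Fin d)) :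
    shellConv c n r (χ.lowPass j) x
      = shellConv c n (2 ^ j * r) (χ.lowPass 0) ((2 : ℝ) ^ j • x) := by
  unfold shellConv
  have h2 : (0 : ℝ) < 2 ^ j := by positivity
  have hS : ∀ t, shellSum d c n r t = shellSum d c n (2 ^ j * r) ((2 : ℝ) ^ j • t) := by
    intro t
    unfold shellSum
    refine Finset.sum_congr rfl fun i _ => ?_
    congr 1
    have : (t ∈ Metric.closedBall 0 (r / 2 ^ i)) ↔
        (2 : ℝ) ^ j • t ∈ Metric.closedBall 0 (2 ^ j * r / 2 ^ i) := by
      simp [norm_smul, mul_div_assoc]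
    by_cases h : t ∈ Metric.closedBall 0 (r / 2 ^ i)
    · rw [indicator_of_mem h, indicator_of_mem (this.1 h)]
    · rw [indicator_of_notMem h, indicator_of_notMem (this.not.1 h)]
  obtain ⟨g, hgd⟩ : ∃ g : EuclideanSpace ℝ (Fin d) → ℂ, g = fun u =>
    shellSum d c n (2 ^ j * r) u * χ.lowPass 0 ((2 : ℝ) ^ j • x - u) := ⟨_, rfl⟩
  have hg : ∀ t, shellSum d c n r t * χ.lowPass j (x - t)
      = ((2 : ℂ) ^ j) ^ d * g ((2 : ℝ) ^ j • t) := by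
    intro t
    rw [hgd, hS, lowPass_apply, smul_sub]
    ring
  simp_rw [hg, ← hgd]
  rw [integral_const_mul, Measure.integral_comp_smul, finrank_euclideanSpace_fin,
    Complex.real_smul, abs_of_nonneg (by positivity)]
  push_cast
  rw [mul_inv_cancel_left₀ (pow_ne_zero _ (pow_ne_zero _ two_ne_zero))]

end FrequencyCutoff

/-! ### Convolution identities and continuity of step functions -/

section
open ContinuousLinearMap
variable {d : ℕ}

/-- Associativity of the convolution of integrable functions of which the first is bounded. -/
theorem convolution_assoc_of_bounded {f g k : EuclideanSpace ℝ (Fin d) → ℂ} {M : ℝ}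
    (hf : Integrable f) (hM : ∀ x, ‖f x‖ ≤ M) (hg : Integrable g) (hk : Integrable k)
    (x : EuclideanSpace ℝ (Fin d)) :
    convolution (convolution f g (mul ℂ ℂ) volume) k (mul ℂ ℂ) volume x
      = convolution f (convolution g k (mul ℂ ℂ) volume) (mul ℂ ℂ) volume x := by
  refine convolution_assoc (mul ℂ ℂ) (mul ℂ ℂ) (mul ℂ ℂ) (mul ℂ ℂ) (fun x y z => mul_assoc x y z)
    hf.aestronglyMeasurable hg.aestronglyMeasurable hk.aestronglyMeasurable
    (hf.ae_convolution_exists _ hg) (hg.norm.ae_convolution_exists _ hk.norm) ?_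
  have h := (hg.norm.integrable_convolution (mul ℝ ℝ) hk.norm).comp_sub_left x
  exact h.bdd_mul (c := M) hf.norm.aestronglyMeasurable
    (Filter.Eventually.of_forall fun t => by simpa using hM t)

theorem SchwartzMap.exists_norm_le (ψ : SchwartzMap (EuclideanSpace ℝ (Fin d)) ℂ) :
    ∃ M : ℝ, ∀ x, ‖ψ x‖ ≤ M := by
  obtain ⟨M, _, hM⟩ := ψ.exists_norm_iteratedFDeriv_le 0 0
  exact ⟨M, fun x => by simpa using hM x⟩

theorem shellConv_eq_convolution (c : ℕ → ℝ) (n : ℕ) (r : ℝ) (g : EuclideanSpace ℝ (Fin d) → ℂ) :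
    shellConv c n r g = convolution (shellSum d c n r) g (mul ℂ ℂ) volume := rfl

theorem norm_shellConv_le (c : ℕ → ℝ) (n : ℕ) (r : ℝ) {g : EuclideanSpace ℝ (Fin d) → ℂ}
    (hg : Integrable g) (x : EuclideanSpace ℝ (Fin d)) :
    ‖shellConv c n r g x‖ ≤ (∑ i ∈ Finset.range n, |c i|) * ∫ t, ‖g t‖ := by
  calc _ ≤ ∫ t, (∑ i ∈ Finset.range n, |c i|) * ‖g (x - t)‖ := by
        refine norm_integral_le_of_norm_le ((hg.comp_sub_left x).norm.const_mul _) ?_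
        refine Filter.Eventually.of_forall fun t => ?_
        rw [norm_mul]
        gcongr
        exact norm_shellSum_le c n r t
    _ = _ := by
        rw [integral_const_mul, integral_sub_left_eq_self (fun t => ‖g t‖)]

/-- Convolving with a step function commutes with filtering, pointwise. -/
theorem shellConv_convolution (c : ℕ → ℝ) (n : ℕ) (r : ℝ) {g k : EuclideanSpace ℝ (Fin d) → ℂ}
    (hg : Integrable g) (hk : Integrable k) (x : EuclideanSpace ℝ (Fin d)) :
    shellConv c n r (convolution g k (mul ℂ ℂ) volume) x
      = ∫ t, shellConv c n r g (x - t) * k t := by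
  rw [shellConv_eq_convolution, ← convolution_assoc_of_bounded (integrable_shellSum c n r)
    (norm_shellSum_le c n r) hg hk, convolution_mul_swap]
  rfl

theorem continuousAt_shellSum (c : ℕ → ℝ) (n : ℕ) (r : ℝ) {x : EuclideanSpace ℝ (Fin d)}
    (hx : ∀ i : ℕ, ‖x‖ ≠ r / 2 ^ i) : ContinuousAt (shellSum d c n r) x := by
  unfold shellSum
  refine tendsto_finsetSum _ fun i _ => tendsto_const_nhds.mul ?_
  rcases lt_or_gt_of_ne (hx i) with h | h
  · refine tendsto_nhds_of_eventually_eq ?_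
    filter_upwards [continuous_norm.continuousAt.eventually_lt_const h] with y hy
    rw [indicator_of_mem (by simpa using hy.le), indicator_of_mem (by simpa using h.le)]
  · refine tendsto_nhds_of_eventually_eq ?_
    filter_upwards [continuous_norm.continuousAt.eventually_const_lt h] with y hy
    rw [indicator_of_notMem (by simpa using hy), indicator_of_notMem (by simpa using h)]

theorem ae_norm_ne_radii {r : ℝ} (hr : 0 < r) :
    ∀ᵐ x : EuclideanSpace ℝ (Fin d), ∀ i : ℕ, ‖x‖ ≠ r / 2 ^ i := by
  refine ae_all_iff.2 fun i => ?_
  have h := Measure.addHaar_sphere_of_ne_zero volume (0 : EuclideanSpace ℝ (Fin d))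
    (r := r / 2 ^ i) (by positivity)
  rw [← compl_mem_ae_iff] at h
  filter_upwards [h] with x hx
  simpa using hx

end

/-! ### Littlewood–Paley expansion of the convolution -/

namespace FrequencyCutoff
open ContinuousLinearMap
variable {d : ℕ} (χ : FrequencyCutoff d)

theorem integrable_kernel (j : ℕ) : Integrable (χ.kernel j) := by
  rw [kernel_eq]; exact SchwartzMap.integrable _

theorem block_eq_convolution (j : ℕ) (f : EuclideanSpace ℝ (Fin d) → ℝ) :
    χ.block j f = convolution (χ.kernel j) (fun x => (f x : ℂ)) (mul ℂ ℂ) volume := by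
  ext x
  rw [convolution_mul_swap]
  rfl

variable {f : EuclideanSpace ℝ (Fin d) → ℝ}

theorem integrable_block (j : ℕ) (hf : Integrable f) : Integrable (χ.block j f) := by
  have hfc : Integrable fun x => (f x : ℂ) := hf.ofReal
  rw [block_eq_convolution]
  exact (χ.integrable_kernel j).integrable_convolution _ hfc

theorem continuous_block (j : ℕ) (hf : Integrable f) : Continuous (χ.block j f) := by
  have hfc : Integrable fun x => (f x : ℂ) := hf.ofReal
  rw [block_eq_convolution, kernel_eq]
  refine BddAbove.continuous_convolution_left_of_integrable _ ?_ (SchwartzMap.continuous _) hfc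
  obtain ⟨M, hM⟩ := SchwartzMap.exists_norm_le (𝓕⁻ (χ.symbolSchwartz j))
  exact ⟨M, by rintro _ ⟨x, rfl⟩; exact hM x⟩

theorem lowPass_convolution_block (j : ℕ) (hf : Integrable f) :
    convolution (χ.lowPass (j + 1)) (χ.block j f) (mul ℂ ℂ) volume = χ.block j f := by
  have hfc : Integrable fun x => (f x : ℂ) := hf.ofReal
  obtain ⟨M, hM⟩ := (χ.lowPass (j + 1)).exists_norm_le
  ext x
  conv_rhs => rw [block_eq_convolution, ← lowPass_convolution_kernel]
  rw [block_eq_convolution, convolution_assoc_of_bounded (χ.lowPass (j + 1)).integrable hM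
    (χ.integrable_kernel j) hfc]

/-- The step function falls on the smooth kernel, where its cancellation is quantified, and `P_j f`
enters only through its size. -/
theorem shellConv_block_eq (c : ℕ → ℝ) (n : ℕ) (r : ℝ) (j : ℕ) (hf : Integrable f)
    (y : EuclideanSpace ℝ (Fin d)) :
    shellConv c n r (χ.block j f) y
      = ∫ t, shellConv c n r (χ.lowPass (j + 1)) (y - t) * χ.block j f t := by
  conv_lhs => rw [← χ.lowPass_convolution_block j hf]
  exact shellConv_convolution c n r (χ.lowPass (j + 1)).integrable (χ.integrable_block j hf) y

theorem measurable_shellConv (c : ℕ → ℝ) (n : ℕ) (r : ℝ)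
    (ψ : SchwartzMap (EuclideanSpace ℝ (Fin d)) ℂ) : Measurable (shellConv c n r ψ) := by
  obtain ⟨M, hM⟩ := ψ.exists_norm_le
  rw [shellConv_eq_convolution]
  refine (BddAbove.continuous_convolution_right_of_integrable (mul ℂ ℂ) ?_
    (integrable_shellSum c n r) ψ.continuous).measurable
  exact ⟨M, by rintro _ ⟨x, rfl⟩; exact hM x⟩

theorem integrable_shellConv_mul (c : ℕ → ℝ) (n : ℕ) (r : ℝ)
    (ψ : SchwartzMap (EuclideanSpace ℝ (Fin d)) ℂ) {g : EuclideanSpace ℝ (Fin d) → ℂ}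
    (hg : Integrable g) (y : EuclideanSpace ℝ (Fin d)) :
    Integrable fun t => shellConv c n r ψ (y - t) * g t :=
  hg.bdd_mul
    ((measurable_shellConv c n r ψ).comp (measurable_const.sub measurable_id)).aestronglyMeasurable
    (Filter.Eventually.of_forall fun t => norm_shellConv_le c n r ψ.integrable (y - t))

/-- The kernels telescope: those of index `0` to `J` add up to `lowPass J`. -/
theorem sum_shellConv_block (c : ℕ → ℝ) (n : ℕ) (r : ℝ) (hf : Integrable f) (J : ℕ)
    (y : EuclideanSpace ℝ (Fin d)) :
    ∑ j ∈ Finset.range (J + 1), shellConv c n r (χ.block j f) y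
      = ∫ t, shellConv c n r (χ.lowPass J) (y - t) * (f t : ℂ) := by
  have hfc : Integrable fun x => (f x : ℂ) := hf.ofReal
  have hblock : ∀ j, shellConv c n r (χ.block j f) y
      = ∫ t, shellConv c n r (χ.kernel j) (y - t) * (f t : ℂ) := fun j => by
    rw [block_eq_convolution, shellConv_convolution c n r (χ.integrable_kernel j) hfc]
  induction J with
  | zero => rw [Finset.sum_range_one, hblock, kernel_zero]
  | succ J ih =>
    rw [Finset.sum_range_succ, ih, hblock, ← integral_add]
    · congr 1 with t
      rw [kernel_succ, ← add_mul]
      congr 1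
      have e : shellConv c n r (fun x => χ.lowPass (J + 1) x - χ.lowPass J x) (y - t)
          = shellConv c n r (χ.lowPass (J + 1)) (y - t) - shellConv c n r (χ.lowPass J) (y - t) := by
        unfold shellConv
        simp_rw [mul_sub]
        have hi : ∀ ψ : SchwartzMap (EuclideanSpace ℝ (Fin d)) ℂ,
            Integrable fun u => shellSum d c n r u * ψ (y - t - u) := fun ψ =>
          (ψ.integrable.comp_sub_left (y - t)).bdd_mul
            (integrable_shellSum c n r).aestronglyMeasurable
            (Filter.Eventually.of_forall (norm_shellSum_le c n r))
        rw [integral_sub (hi _) (hi _)]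
      rw [e]
      ring
    · exact integrable_shellConv_mul c n r _ hfc y
    · have h := integrable_shellConv_mul c n r (𝓕⁻ (χ.symbolSchwartz (J + 1))) hfc y
      rwa [← kernel_eq] at h

theorem tendsto_shellConv_lowPass (c : ℕ → ℝ) (n : ℕ) (r : ℝ) {x : EuclideanSpace ℝ (Fin d)}
    (hx : ContinuousAt (shellSum d c n r) x) :
    Filter.Tendsto (fun J => shellConv c n r (χ.lowPass J) x) Filter.atTop
      (nhds (shellSum d c n r x)) := by
  have e : ∀ J : ℕ, shellConv c n r (χ.lowPass J) x
      = ∫ w, shellSum d c n r (x - ((2 : ℝ) ^ J)⁻¹ • w) * χ.lowPass 0 w := by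
    intro J
    rw [shellConv_eq_convolution, convolution_mul_swap]
    obtain ⟨g, hgd⟩ : ∃ g : EuclideanSpace ℝ (Fin d) → ℂ, g = fun w =>
      shellSum d c n r (x - ((2 : ℝ) ^ J)⁻¹ • w) * χ.lowPass 0 w := ⟨_, rfl⟩
    have hg : ∀ t, shellSum d c n r (x - t) * χ.lowPass J t
        = ((2 : ℂ) ^ J) ^ d * g ((2 : ℝ) ^ J • t) := by
      intro t
      rw [hgd, lowPass_apply]
      simp only []
      rw [inv_smul_smul₀ (by positivity)]
      ring
    simp_rw [hg, ← hgd]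
    rw [integral_const_mul, Measure.integral_comp_smul, finrank_euclideanSpace_fin,
      Complex.real_smul, abs_of_nonneg (by positivity)]
    push_cast
    rw [mul_inv_cancel_left₀ (pow_ne_zero _ (pow_ne_zero _ two_ne_zero))]
  simp_rw [e]
  have hlim : shellSum d c n r x = ∫ w, shellSum d c n r x * χ.lowPass 0 w := by
    rw [integral_const_mul, integral_lowPass_zero, mul_one]
  rw [hlim]
  refine tendsto_integral_of_dominated_convergence
    (fun w => (∑ i ∈ Finset.range n, |c i|) * ‖χ.lowPass 0 w‖) (fun J => ?_)
    ((χ.lowPass 0).integrable.norm.const_mul _) (fun J => ?_) ?_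
  · exact (((measurable_shellSum c n r).comp (by fun_prop)).mul
      (χ.lowPass 0).continuous.measurable).aestronglyMeasurable
  · refine Filter.Eventually.of_forall fun w => ?_
    rw [norm_mul]
    gcongr
    exact norm_shellSum_le c n r _
  · refine Filter.Eventually.of_forall fun w => Filter.Tendsto.mul_const _ ?_
    refine hx.tendsto.comp ?_
    have h2 : Filter.Tendsto (fun J : ℕ => ((2 : ℝ) ^ J)⁻¹) Filter.atTop (nhds 0) :=
      (tendsto_pow_atTop_atTop_of_one_lt one_lt_two).inv_tendsto_atTop
    simpa using (tendsto_const_nhds (x := x)).sub (h2.smul_const w)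

/-- The low-pass kernels act on the step function, not on `f`. They converge there off finitely or
countably many spheres, a null set, so for merely integrable `f` the limit holds at every `y`. -/
theorem tendsto_sum_shellConv_block (c : ℕ → ℝ) (n : ℕ) {r : ℝ} (hr : 0 < r) (hf : Integrable f)
    (y : EuclideanSpace ℝ (Fin d)) :
    Filter.Tendsto (fun J => ∑ j ∈ Finset.range (J + 1), shellConv c n r (χ.block j f) y)
      Filter.atTop (nhds (shellConv c n r (fun x => (f x : ℂ)) y)) := by
  have hfc : Integrable fun x => (f x : ℂ) := hf.ofReal
  simp_rw [sum_shellConv_block χ c n r hf]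
  rw [shellConv_eq_convolution, convolution_mul_swap]
  refine tendsto_integral_of_dominated_convergence
    (fun t => ((∑ i ∈ Finset.range n, |c i|) * ∫ w, ‖χ.lowPass 0 w‖) * ‖(f t : ℂ)‖) (fun J => ?_)
    (hfc.norm.const_mul _) (fun J => ?_) ?_
  · exact (integrable_shellConv_mul c n r _ hfc y).aestronglyMeasurable
  · refine Filter.Eventually.of_forall fun t => ?_
    -- Rescaling to `lowPass 0` makes the dominating constant independent of `J`.
    rw [norm_mul, shellConv_lowPass]
    gcongr
    exact norm_shellConv_le c n _ (χ.lowPass 0).integrable _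
  · have h := (quasiMeasurePreserving_sub_left_of_right_invariant
      (volume : Measure (EuclideanSpace ℝ (Fin d))) y).ae (ae_norm_ne_radii hr)
    filter_upwards [h] with t ht
    exact (χ.tendsto_shellConv_lowPass c n r (continuousAt_shellSum c n r ht)).mul_const _

theorem enorm_shellConv_le_tsum (c : ℕ → ℝ) (n : ℕ) {r : ℝ} (hr : 0 < r) (hf : Integrable f)
    (y : EuclideanSpace ℝ (Fin d)) :
    ‖shellConv c n r (fun x => (f x : ℂ)) y‖ₑ ≤ ∑' j, ‖shellConv c n r (χ.block j f) y‖ₑ := by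
  refine le_of_tendsto (χ.tendsto_sum_shellConv_block c n hr hf y).enorm
    (Filter.Eventually.of_forall fun J => ?_)
  exact (enorm_sum_le _ _).trans (ENNReal.sum_le_tsum _)

end FrequencyCutoff

/-! ### Block estimates and their summation -/

theorem ENNReal.eLpNorm_const_mul {X : Type*} [MeasurableSpace X] {μ : Measure X}
    {p : ℝ≥0∞} (hp : 1 ≤ p) (a : ℝ≥0∞) {g : X → ℝ≥0∞} (hg : Measurable g) :
    eLpNorm (fun x => a * g x) p μ = a * eLpNorm g p μ := by
  by_cases hpt : p = ⊤
  · subst hpt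
    simp only [eLpNorm_exponent_top, eLpNormEssSup]
    exact ENNReal.essSup_const_mul
  · have hp0 : 0 < p.toReal := ENNReal.toReal_pos (by positivity) hpt
    simp only [ENNReal.eLpNorm_eq_lintegral_rpow hp hpt, ENNReal.mul_rpow_of_nonneg _ _ hp0.le]
    rw [lintegral_const_mul _ (hg.pow_const _), ENNReal.mul_rpow_of_nonneg _ _ (by positivity),
      ← ENNReal.rpow_mul, mul_one_div_cancel hp0.ne', ENNReal.rpow_one]

namespace FrequencyCutoff
variable {d : ℕ} (χ : FrequencyCutoff d) {f : EuclideanSpace ℝ (Fin d) → ℝ}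

/-- The weight `(1 + 2^{j+1} |x|)^{-γ}` dominating the `j`-th filtered step function. -/
def decayWeight (d : ℕ) (γ : ℝ) (j : ℕ) (x : EuclideanSpace ℝ (Fin d)) : ℝ≥0∞ :=
  ENNReal.ofReal ((1 + ‖(2 : ℝ) ^ (j + 1) • x‖) ^ (-γ))

theorem measurable_decayWeight (γ : ℝ) (j : ℕ) : Measurable (decayWeight d γ j) := by
  unfold decayWeight; fun_prop

theorem lintegral_decayWeight (γ : ℝ) (j : ℕ) :
    ∫⁻ x, decayWeight d γ j x = ENNReal.ofReal (((2 : ℝ) ^ (j + 1)) ^ (-(d : ℝ))) *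
      ∫⁻ x : EuclideanSpace ℝ (Fin d), ENNReal.ofReal ((1 + ‖x‖) ^ (-γ)) := by
  have h2 : (0 : ℝ) < 2 ^ (j + 1) := by positivity
  have hm : Measurable fun x : EuclideanSpace ℝ (Fin d) => ENNReal.ofReal ((1 + ‖x‖) ^ (-γ)) := by
    fun_prop
  unfold decayWeight
  rw [← lintegral_map (f := fun x : EuclideanSpace ℝ (Fin d) =>
      ENNReal.ofReal ((1 + ‖x‖) ^ (-γ))) (g := fun x => (2 : ℝ) ^ (j + 1) • x) hm (by fun_prop),
    Measure.map_addHaar_smul _ h2.ne', lintegral_smul_measure, finrank_euclideanSpace_fin,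
    abs_of_nonneg (by positivity), Real.rpow_neg h2.le, Real.rpow_natCast, smul_eq_mul]

/-- The majorant of the `j`-th block. -/
def blockMajorant (γ : ℝ) (j : ℕ) (f : EuclideanSpace ℝ (Fin d) → ℝ)
    (y : EuclideanSpace ℝ (Fin d)) : ℝ≥0∞ :=
  ∫⁻ t, decayWeight d γ j (y - t) * ‖χ.block j f t‖ₑ

theorem measurable_blockMajorant (γ : ℝ) (j : ℕ) (hf : Integrable f) :
    Measurable (χ.blockMajorant γ j f) := by
  have h1 : Measurable fun z : EuclideanSpace ℝ (Fin d) × EuclideanSpace ℝ (Fin d) =>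
      decayWeight d γ j (z.1 - z.2) * ‖χ.block j f z.2‖ₑ :=
    ((measurable_decayWeight γ j).comp (measurable_fst.sub measurable_snd)).mul
      ((χ.continuous_block j hf).measurable.enorm.comp measurable_snd)
  exact h1.lintegral_prod_right'

theorem eLpNorm_blockMajorant_le (γ : ℝ) (j : ℕ) (hf : Integrable f) {q : ℝ≥0∞} (hq : 1 ≤ q) :
    eLpNorm (χ.blockMajorant γ j f) q volume
      ≤ (∫⁻ x, decayWeight d γ j x) * eLpNorm (χ.block j f) q volume := by
  have h := ENNReal.eLpNorm_lconvolution_le volume hq (decayWeight d γ j)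
    (fun t => ‖χ.block j f t‖ₑ) (measurable_decayWeight γ j)
    (χ.continuous_block j hf).measurable.enorm
  rwa [eLpNorm_enorm] at h

/-- The factor `r^{-α-d}` cancels against `(2^{j+1} r)^{α+d}`, so `r` survives only in the bump and
the variables `r` and `y` separate. -/
theorem enorm_shellConv_block_le {c : ℕ → ℝ} {n : ℕ} {α ε γ C : ℝ} (hC0 : 0 ≤ C)
    (hC : ∀ x r, 0 < r → ‖shellConv c n r (χ.lowPass 0) x‖
        ≤ C * r ^ (α + d) * powerBump ε r * (1 + ‖x‖) ^ (-γ))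
    {r : ℝ} (hr : 0 < r) (j : ℕ) (hf : Integrable f)
    (y : EuclideanSpace ℝ (Fin d)) :
    ENNReal.ofReal (r ^ (-α - d)) * ‖shellConv c n r (χ.block j f) y‖ₑ
      ≤ ENNReal.ofReal (C * ((2 : ℝ) ^ (j + 1)) ^ (α + d)) * χ.blockMajorant γ j f y *
        ENNReal.ofReal (powerBump ε (2 ^ (j + 1) * r)) := by
  have h2 : (0 : ℝ) < 2 ^ (j + 1) := by positivity
  have hb : ∀ x, ENNReal.ofReal (r ^ (-α - d)) * ‖shellConv c n r (χ.lowPass (j + 1)) x‖ₑ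
      ≤ ENNReal.ofReal (C * ((2 : ℝ) ^ (j + 1)) ^ (α + d)) *
        ENNReal.ofReal (powerBump ε (2 ^ (j + 1) * r)) * decayWeight d γ j x := by
    intro x
    have hpb := powerBump_nonneg (ε := ε) (mul_pos h2 hr).le
    rw [← ofReal_norm, decayWeight, ← ENNReal.ofReal_mul (by positivity),
      ← ENNReal.ofReal_mul (by positivity), ← ENNReal.ofReal_mul (by positivity)]
    refine ENNReal.ofReal_le_ofReal ?_
    rw [shellConv_lowPass]
    calc _ ≤ r ^ (-α - d) * _ := mul_le_mul_of_nonneg_left (hC _ _ (by positivity)) (by positivity)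
      _ = _ := by
        rw [Real.mul_rpow h2.le hr.le, show -α - (d : ℝ) = -(α + d) by ring, Real.rpow_neg hr.le]
        have : 0 < r ^ (α + d) := by positivity
        field_simp
  have hm : Measurable fun t => decayWeight d γ j (y - t) * ‖χ.block j f t‖ₑ :=
    ((measurable_decayWeight γ j).comp (measurable_const.sub measurable_id)).mul
      (χ.continuous_block j hf).measurable.enorm
  calc _ ≤ ENNReal.ofReal (r ^ (-α - d)) *
        ∫⁻ t, ‖shellConv c n r (χ.lowPass (j + 1)) (y - t)‖ₑ * ‖χ.block j f t‖ₑ := by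
        rw [shellConv_block_eq χ c n r j hf]
        refine mul_le_mul_right ((enorm_integral_le_lintegral_enorm _).trans_eq ?_) _
        simp_rw [enorm_mul]
    _ = ∫⁻ t, ENNReal.ofReal (r ^ (-α - d)) *
        (‖shellConv c n r (χ.lowPass (j + 1)) (y - t)‖ₑ * ‖χ.block j f t‖ₑ) := by
        rw [lintegral_const_mul' _ _ ENNReal.ofReal_ne_top]
    _ ≤ ∫⁻ t, ENNReal.ofReal (C * ((2 : ℝ) ^ (j + 1)) ^ (α + d)) *
        ENNReal.ofReal (powerBump ε (2 ^ (j + 1) * r)) *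
          (decayWeight d γ j (y - t) * ‖χ.block j f t‖ₑ) := by
        refine lintegral_mono fun t => ?_
        rw [← mul_assoc, ← mul_assoc]
        exact mul_le_mul_left (hb _) _
    _ = _ := by
        rw [lintegral_const_mul _ hm, blockMajorant]
        ring

end FrequencyCutoff

theorem sbeNorm_withDensity_le {d : ℕ} (χ : FrequencyCutoff d)
    {α ε γ C : ℝ} (hε : 0 < ε) (hC0 : 0 ≤ C) {c : ℕ → ℝ}
    (hc : ∀ (F : ℝ → ℝ) (r : ℝ), dyadicDiff (sbeOrder d α) F r
      = ∑ i ∈ Finset.range (sbeOrder d α + 2), c i * F (r / 2 ^ i))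
    (hC : ∀ x r, 0 < r → ‖shellConv c (sbeOrder d α + 2) r (χ.lowPass 0) x‖
        ≤ C * r ^ (α + d) * powerBump ε r * (1 + ‖x‖) ^ (-γ))
    {p q : ℝ≥0∞} (hp : 1 ≤ p) (hq : 1 ≤ q)
    {f : EuclideanSpace ℝ (Fin d) → ℝ} (hf : Integrable f) :
    sbeNorm α p q (volume.withDensityᵥ f) ≤
      (ENNReal.ofReal (C * 2 ^ α) * (ENNReal.ofReal (2 / ε) + 1) *
        ∫⁻ x : EuclideanSpace ℝ (Fin d), ENNReal.ofReal ((1 + ‖x‖) ^ (-γ))) *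
      χ.besovNorm α q 1 f := by
  set n := sbeOrder d α + 2
  set H := ENNReal.ofReal (2 / ε) + 1
  set a : ℕ → ℝ≥0∞ := fun j => ENNReal.ofReal (C * ((2 : ℝ) ^ (j + 1)) ^ (α + d))
  have hbump : ∀ j : ℕ, Measurable fun r =>
      ENNReal.ofReal (powerBump ε (2 ^ (j + 1) * r)) := fun j =>
    ((measurable_powerBump ε).comp (measurable_const_mul _)).ennreal_ofReal
  have hinner : ∀ y, eLpNorm (fun r : ℝ => r ^ (-α - (d : ℝ)) *
        dyadicDiff (sbeOrder d α) (fun s => ballMass (volume.withDensityᵥ f) s y) r) p haarPos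
      ≤ ∑' j, H * a j * χ.blockMajorant γ j f y := by
    intro y
    calc _ ≤ eLpNorm (fun r => ∑' j, a j * χ.blockMajorant γ j f y *
          ENNReal.ofReal (powerBump ε (2 ^ (j + 1) * r))) p haarPos := by
          refine eLpNorm_mono_enorm_ae ?_
          filter_upwards [ae_haarPos_pos] with r hr
          have e : ‖dyadicDiff (sbeOrder d α)
              (fun s => ballMass (volume.withDensityᵥ f) s y) r‖ₑ
              = ‖shellConv c n r (fun x => (f x : ℂ)) y‖ₑ := by
            rw [← ofReal_dyadicDiff_ballMass hc hf r y]
            simp [enorm_eq_nnnorm]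
          rw [enorm_mul, e, Real.enorm_eq_ofReal (by positivity), enorm_eq_self]
          refine (mul_le_mul_right (χ.enorm_shellConv_le_tsum c n hr hf y) _).trans ?_
          rw [← ENNReal.tsum_mul_left]
          exact ENNReal.tsum_le_tsum fun j => χ.enorm_shellConv_block_le hC0 hC hr j hf y
      _ ≤ ∑' j, eLpNorm (fun r => a j * χ.blockMajorant γ j f y *
          ENNReal.ofReal (powerBump ε (2 ^ (j + 1) * r))) p haarPos :=
          ENNReal.eLpNorm_tsum_le hp _ fun j => (hbump j).const_mul _
      _ ≤ _ := by
          refine ENNReal.tsum_le_tsum fun j => ?_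
          rw [ENNReal.eLpNorm_const_mul hp _ (hbump j), mul_comm, ← mul_assoc]
          gcongr
          exact eLpNorm_powerBump_haarPos_le hε (by positivity) hp
  calc sbeNorm α p q (volume.withDensityᵥ f)
      ≤ eLpNorm (fun y => ∑' j, H * a j * χ.blockMajorant γ j f y) q volume :=
        eLpNorm_mono_enorm hinner
    _ ≤ ∑' j, eLpNorm (fun y => H * a j * χ.blockMajorant γ j f y) q volume :=
        ENNReal.eLpNorm_tsum_le hq _ fun j => (χ.measurable_blockMajorant γ j hf).const_mul _
    _ ≤ ∑' j : ℕ, (ENNReal.ofReal (C * 2 ^ α) * H *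
        ∫⁻ x : EuclideanSpace ℝ (Fin d), ENNReal.ofReal ((1 + ‖x‖) ^ (-γ))) *
        (ENNReal.ofReal ((2 : ℝ) ^ ((j : ℝ) * α)) * eLpNorm (χ.block j f) q volume) := by
        refine ENNReal.tsum_le_tsum fun j => ?_
        rw [ENNReal.eLpNorm_const_mul hq _ (χ.measurable_blockMajorant γ j hf)]
        refine (mul_le_mul_right (χ.eLpNorm_blockMajorant_le γ j hf hq) _).trans (le_of_eq ?_)
        rw [FrequencyCutoff.lintegral_decayWeight]
        -- The `d`-th powers of `2^{j+1}` cancel: `(2^{j+1})^{α+d} (2^{j+1})^{-d} = 2^α 2^{jα}`.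
        have e : a j * ENNReal.ofReal (((2 : ℝ) ^ (j + 1)) ^ (-(d : ℝ)))
            = ENNReal.ofReal (C * 2 ^ α) * ENNReal.ofReal ((2 : ℝ) ^ ((j : ℝ) * α)) := by
          rw [← ENNReal.ofReal_mul (by positivity), ← ENNReal.ofReal_mul (by positivity)]
          congr 1
          rw [mul_assoc, mul_assoc, ← Real.rpow_add (by positivity), ← Real.rpow_natCast,
            ← Real.rpow_mul (by norm_num), ← Real.rpow_add (by norm_num)]
          congr 2
          push_cast
          ring
        calc _ = H * (a j * ENNReal.ofReal (((2 : ℝ) ^ (j + 1)) ^ (-(d : ℝ)))) *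
              (∫⁻ x : EuclideanSpace ℝ (Fin d), ENNReal.ofReal ((1 + ‖x‖) ^ (-γ))) *
              eLpNorm (χ.block j f) q volume := by ring
          _ = _ := by rw [e]; ring
    _ = _ := by
        rw [ENNReal.tsum_mul_left, FrequencyCutoff.besovNorm, eLpNorm_one_eq_lintegral_enorm,
          lintegral_count]
        simp

/-! ### The order of the difference and the conclusion -/

/-- Non-integrality enters here: `⌈α - 1⌉ = ⌊α⌋`. For integer `α` the order would be `d + α - 1`, so
`m = α - 1`, leaving no room for `ε > 0` at small radii. -/
theorem sbeOrder_eq {d : ℕ} {α : ℝ} (hα : 0 < α) (hαn : ∀ n : ℕ, α ≠ n) :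
    sbeOrder d α = d + ⌊α⌋₊ := by
  have h1 : (⌊α⌋₊ : ℝ) < α := lt_of_le_of_ne (Nat.floor_le hα.le) (hαn _).symm
  have h2 : α < ⌊α⌋₊ + 1 := Nat.lt_floor_add_one α
  rw [sbeOrder]
  refine le_antisymm (Nat.ceil_le.2 ?_) ?_
  · push_cast; linarith
  · rw [Nat.le_iff_lt_add_one, ← Nat.cast_lt (α := ℝ)]
    have := Nat.le_ceil (α + d - 1)
    push_cast
    linarith

end

theorem proposition2p3 (d : ℕ) (hd : 1 ≤ d) (α : ℝ) (hα : 0 < α) (hαn : ∀ n : ℕ, α ≠ n)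
    (q : ℝ≥0∞) (hq : 1 ≤ q) (χ : FrequencyCutoff d) (p : ℝ≥0∞) (hp : 1 ≤ p) :
    ∃ C : ℝ≥0, ∀ (μ : SignedMeasure (EuclideanSpace ℝ (Fin d)))
      (f : EuclideanSpace ℝ (Fin d) → ℝ),
      Integrable f volume → μ = volume.withDensityᵥ f → CompactlySupported μ →
      χ.MemBesov α q 1 f →
      sbeNorm α p q μ ≤ C * χ.besovNorm α q 1 f := by
  obtain ⟨c, hc⟩ := exists_dyadicDiff_eq_sum (sbeOrder d α)
  have hmom : ∀ l ≤ d + ⌊α⌋₊, ∀ r : ℝ,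
      ∑ i ∈ Finset.range (sbeOrder d α + 2), c i * (r / 2 ^ i) ^ l = 0 := by
    intro l hl r
    rw [← hc (fun s => s ^ l) r]
    exact dyadicDiff_pow_eq_zero (by rwa [sbeOrder_eq hα hαn]) r
  have hfl : α < ⌊α⌋₊ + 1 := Nat.lt_floor_add_one α
  -- The largest `ε` allowed by `exists_norm_shellConv_le` with `m = ⌊α⌋`.
  have hε : 0 < min ((⌊α⌋₊ : ℝ) + 1 - α) (α / 2) := lt_min (by linarith) (by linarith)
  obtain ⟨C, hC0, hC⟩ := exists_norm_shellConv_le hmom (χ.lowPass 0) hα hε.le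
    (min_le_left _ _) (min_le_right _ _)
  have hJ : ∫⁻ x : EuclideanSpace ℝ (Fin d),
      ENNReal.ofReal ((1 + ‖x‖) ^ (-((d : ℝ) + α / 2))) < ⊤ :=
    finite_integral_one_add_norm (by simpa using hα)
  set A := ENNReal.ofReal (C * 2 ^ α) *
    (ENNReal.ofReal (2 / min ((⌊α⌋₊ : ℝ) + 1 - α) (α / 2)) + 1) *
      ∫⁻ x : EuclideanSpace ℝ (Fin d), ENNReal.ofReal ((1 + ‖x‖) ^ (-((d : ℝ) + α / 2)))
  have hA : A ≠ ⊤ := ENNReal.mul_ne_top (ENNReal.mul_ne_top ENNReal.ofReal_ne_top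
    (ENNReal.add_ne_top.2 ⟨ENNReal.ofReal_ne_top, ENNReal.one_ne_top⟩)) hJ.ne
  refine ⟨A.toNNReal, fun μ f hf hμ _ _ => ?_⟩
  rw [ENNReal.coe_toNNReal hA, hμ]
  exact sbeNorm_withDensity_le χ hε hC0 hc hC hp hq hf
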